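/- Let $(h_t)_{t\ge 1}$ be i.i.d. real random variables with $\mathsf P(h_1=0)<1$, let $(w_t)_{t\ge1}$ be i.i.d. with $\mathsf E[w_t]=0$ and $\mathsf{Var}(w_t)=\sigma^2\in(0,\infty)$, independent of $(h_t)$, and let $y_t=h_t x+w_t$ with an unknown deterministic $x\in\mathbb R$. Put $u_t=\sum_{\tau=1}^t h_\tau^2$, $v_t=\sum_{\tau=1}^t h_\tau y_\tau$ and $\mathcal H_t=\sigma(h_1,\dots,h_t)$ ($\mathcal H_0$ trivial). A pair $(\mathcal T,\hat x_{\mathcal T})$ is called admissible if $\mathcal T$ is an almost surely finite $\{\mathcal H_t\}$-stopping time and $\hat x_t$ is, for each $t$, a measurable function of $(h_1,\dots,h_t,y_1,\dots,y_t)$ such that, for every value $x$ of the parameter, $\hat x_{\mathcal T}$ is integrable and $\mathsf E[\hat x_{\mathcal T}\mid\mathcal H_{\mathcal T}]=x$ almost surely; it is linear if $\hat x_t=\sum_{\tau\le t}a_{t,\tau}y_\tau$ with weights $a_{t,\tau}$ that are measurable functions of $(h_1,\dots,h_t)$. For $C>0$ consider the problem of minimizing $\mathsf E[\mathcal T]$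 subject to $\mathsf{Var}(\hat x_{\mathcal T})\le C$, over all linear admissible pairs or, if $w_t\sim\mathcal N(0,\sigma^2)$, over all admissible pairs. For $C''>0$ let $\mathcal T=\min\{t\ge1: u_t\ge 1/C''\}$, and suppose that $C''$ is such that $\mathsf E[\sigma^2/u_{\mathcal T}]=C$. Then, for every value of $x$, the pair formed by $\mathcal T$ and the least-squares estimator $v_{\mathcal T}/u_{\mathcal T}$ is linear and admissible, $\mathsf E[\mathcal T]<\infty$, $\mathsf{Var}(v_{\mathcal T}/u_{\mathcal T})=C$, and this pair solves the problem in the linear class for any noise law, and in the class of all admissible pairs if the noise is Gaussian. Moreover $v_{\mathcal T}/u_{\mathcal T}$ has the smallest variance among the estimators of the respective class that use the same stopping time $\mathcal T$. If the law of $h_1$ has no atoms and $0<C<\sigma^2\,\mathsf E[1/h_1^2]$ (the right-hand side may be $\infty$), then a threshold $C''>0$ with $\mathsf E[\sigma^2/u_{\mathcal T}]=C$ exists. -/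

import Mathlib

open MeasureTheory ProbabilityTheory
open scoped ENNReal

noncomputable section

namespace SeqEst

/-!
Scalar linear model `y = h x + w`. Sequences are indexed from `0`, so `h i` and `w i` are the
coefficient and the noise of the `(i + 1)`-st sample, and the data available at time `t` (after
`t` samples) are those with index `i < t`.
-/

variable {Ω : Type*}

/-- The filtration `𝓗_t = σ(h_1, …, h_t)` of the coefficients; `𝓗_0` is trivial. -/
def coeffFiltration [m : MeasurableSpace Ω] (h : ℕ → Ω → ℝ) (hh : ∀ i, Measurable (h i)) :
    Filtration ℕ m where
  seq t := ⨆ i : ℕ, ⨆ _ : i < t, MeasurableSpace.comap (h i) inferInstance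
  mono' := fun _ _ hst =>
    iSup_le fun i => iSup_le fun hi => le_iSup_of_le i (le_iSup_of_le (hi.trans_le hst) le_rfl)
  le' := fun _ => iSup_le fun i => iSup_le fun _ => (hh i).comap_le

/-- `u_t = ∑_{τ ≤ t} h_τ²`. -/
def energy (h : ℕ → Ω → ℝ) (t : ℕ) (ω : Ω) : ℝ := ∑ i ∈ Finset.range t, h i ω ^ 2

/-- `min {t ≥ 1 : u_t ≥ 1 / c}`, with value `⊤` if there is no such `t`. -/
def thresholdTime (h : ℕ → Ω → ℝ) (c : ℝ) : Ω → WithTop ℕ :=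
  hittingAfter (energy h) (Set.Ici (1 / c)) 1

/-- The expectation of an extended stopping time, in `[0, ∞]`. -/
def expectedTime [MeasurableSpace Ω] (P : Measure Ω) (T : Ω → WithTop ℕ) : ℝ≥0∞ :=
  ∫⁻ ω, ENat.toENNReal (T ω) ∂P

/-- A sequential estimator: for each `t` a function of the first `t` coefficients and the first
`t` observations. -/
abbrev Estimator : Type := (t : ℕ) → (Fin t → ℝ) × (Fin t → ℝ) → ℝ

/-- Estimators `A_t Y_t` that are linear in the observations, with a weight vector `A_t` that is
a measurable function of the coefficients. -/
def Estimator.IsLinear (φ : Estimator) : Prop :=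
  ∃ a : (t : ℕ) → (Fin t → ℝ) → (Fin t → ℝ), (∀ t, Measurable (a t)) ∧
    ∀ t c y, φ t (c, y) = ∑ i, a t c i * y i

/-- The least squares estimator `v_t / u_t`, with `v_t = ∑ h_τ y_τ` and `u_t = ∑ h_τ²`. -/
def leastSquares : Estimator := fun _ d => (∑ i, d.1 i * d.2 i) / ∑ i, d.1 i ^ 2

/-- The estimate `x̂_T` when the value of the parameter is `x`. The value on `{T = ⊤}` is
irrelevant: it is only used for almost surely finite `T`. -/
def estimate (h w : ℕ → Ω → ℝ) (x : ℝ) (T : Ω → WithTop ℕ) (φ : Estimator) (ω : Ω) : ℝ :=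
  φ ((T ω).untopD 0) (fun i => h i ω, fun i => h i ω * x + w i ω)

/-- `(T, x̂_T)` consists of an almost surely finite stopping time of the coefficient filtration
and an estimator that is unbiased given the coefficients observed up to `T`, whatever the value
of the parameter. -/
structure IsAdmissible [MeasurableSpace Ω] (P : Measure Ω) (h w : ℕ → Ω → ℝ)
    (hh : ∀ i, Measurable (h i)) (T : Ω → WithTop ℕ) (φ : Estimator) : Prop where
  stopping : IsStoppingTime (coeffFiltration h hh) T
  finite : ∀ᵐ ω ∂P, T ω ≠ ⊤
  measurable : ∀ t, Measurable (φ t)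
  integrable : ∀ x : ℝ, Integrable (estimate h w x T φ) P
  unbiased : ∀ x : ℝ, P[estimate h w x T φ | stopping.measurableSpace] =ᵐ[P] fun _ => x

/-- `(T, x̂_T)` is feasible for the parameter value `x`, the accuracy level `C` and the class `K`
of estimators: it is admissible, belongs to the class, and `Var(x̂_T) ≤ C`. -/
def IsFeasible [MeasurableSpace Ω] (P : Measure Ω) (h w : ℕ → Ω → ℝ)
    (hh : ∀ i, Measurable (h i)) (K : Set Estimator) (x C : ℝ)
    (T : Ω → WithTop ℕ) (φ : Estimator) : Prop :=
  φ ∈ K ∧ IsAdmissible P h w hh T φ ∧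
    evariance (estimate h w x T φ) P ≤ ENNReal.ofReal C

/-- `(T, x̂_T)` minimizes `E[T]` over all feasible pairs. -/
def IsOptimalPair [MeasurableSpace Ω] (P : Measure Ω) (h w : ℕ → Ω → ℝ)
    (hh : ∀ i, Measurable (h i)) (K : Set Estimator) (x C : ℝ)
    (T : Ω → WithTop ℕ) (φ : Estimator) : Prop :=
  IsFeasible P h w hh K x C T φ ∧
    ∀ (T' : Ω → WithTop ℕ) (φ' : Estimator), IsFeasible P h w hh K x C T' φ' →
      expectedTime P T ≤ expectedTime P T'

/-- `φ` has the smallest variance at time `T` among the admissible estimators of the class `K`. -/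
def IsOptimalEstimatorAt [MeasurableSpace Ω] (P : Measure Ω) (h w : ℕ → Ω → ℝ)
    (hh : ∀ i, Measurable (h i)) (K : Set Estimator) (x : ℝ)
    (T : Ω → WithTop ℕ) (φ : Estimator) : Prop :=
  (φ ∈ K ∧ IsAdmissible P h w hh T φ) ∧
    ∀ φ' ∈ K, IsAdmissible P h w hh T φ' →
      evariance (estimate h w x T φ) P ≤ evariance (estimate h w x T φ') P

end SeqEst

end

/-! ### Gaussian shifts and the Cramér–Rao inequality. -/

namespace SeqEst

/-! The problem splits into an estimation bound and an optimal stopping problem.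

Estimation. Since `T` depends on the coefficients only, the noise given the coefficients seen up to
`T` is still i.i.d. with its original law. Conditionally one is in a fixed-design model, where a
linear unbiased estimator has variance at least `σ² / u_T` by Gauss–Markov, and with Gaussian noise
every unbiased estimator does by Cramér–Rao. Integrating gives `Var ≥ E[σ² / u_T]` for every
admissible pair (`IsAdmissible.lintegral_div_energy_le_of_isLinear`,
`IsAdmissible.lintegral_div_energy_le_of_gaussian`), with equality for least squares at the
threshold time (`leastSquares_thresholdTime`). It remains to minimize `E[T]` under a bound on `E[1 /
u_T]`.

Stopping. One more sample at energy `r` lowers the inverse energy on average by `ψ(r) = E[1/r - 1/(r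
+ h²)]`, which decreases in `r`. The threshold rule `T` samples exactly while `u_t < 1/c`, that is,
while a sample is worth at least `ψ(1/c)`. For a competitor `T'`, each sample that it saves on `{T'
≤ t < T}` costs at least `ψ(1/c)` in inverse energy, and each sample that it adds on `{T ≤ t < T'}`
gains at most `ψ(1/c)`. If `E[1/u_{T'}] ≤ E[1/u_T]`, the expected number added is therefore at least
the expected number saved, so `E[T] ≤ E[T']` (`expectedTime_thresholdTime_le`).

Existence. The map `c ↦ E[σ² / u_T]` is at most `σ² c`, is continuous when `h` has no atoms, and by
Fatou exceeds every level below `σ² E[1/h²]` for large `c`; the intermediate value theorem finishes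
(`exists_threshold`). -/

/-- It suffices to test boxes. There the indicator times the product density is a product of
functions of single coordinates, and independence factors the integral. -/
theorem pi_withDensity {ι : Type*} [Fintype ι] (ν : Measure ℝ) [IsProbabilityMeasure ν]
    (ρ : ι → ℝ → ℝ≥0∞) (hρ : ∀ i, Measurable (ρ i))
    [∀ i, IsProbabilityMeasure (ν.withDensity (ρ i))] :
    Measure.pi (fun i => ν.withDensity (ρ i)) =
      (Measure.pi fun _ => ν).withDensity fun w => ∏ i, ρ i (w i) := by
  refine Measure.pi_eq fun s hs => ?_
  have hmeas : ∀ i, Measurable fun w : ι → ℝ => (s i).indicator (ρ i) (w i) := fun i =>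
    ((hρ i).indicator (hs i)).comp (measurable_pi_apply i)
  have hind : iIndepFun (fun i (w : ι → ℝ) => (s i).indicator (ρ i) (w i))
      (Measure.pi fun _ => ν) :=
    iIndepFun_pi fun i => ((hρ i).indicator (hs i)).aemeasurable
  rw [withDensity_apply _ (MeasurableSet.univ_pi hs),
    ← lintegral_indicator (MeasurableSet.univ_pi hs)]
  have heq : (Set.univ.pi s).indicator (fun w : ι → ℝ => ∏ i, ρ i (w i)) =
      fun w => ∏ i, (s i).indicator (ρ i) (w i) := by
    ext w
    by_cases hw : w ∈ Set.univ.pi s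
    · rw [Set.indicator_of_mem hw]
      exact Finset.prod_congr rfl fun i _ => (Set.indicator_of_mem (hw i trivial) _).symm
    · rw [Set.indicator_of_notMem hw]
      obtain ⟨i, hi⟩ : ∃ i, w i ∉ s i := by simpa [Set.mem_univ_pi] using hw
      exact (Finset.prod_eq_zero (Finset.mem_univ i) (Set.indicator_of_notMem hi _)).symm
  rw [heq, lintegral_prod_eq_prod_lintegral_of_indepFun Finset.univ _ hind hmeas]
  refine Finset.prod_congr rfl fun i _ => ?_
  rw [withDensity_apply _ (hs i), ← lintegral_indicator (hs i)]
  exact (measurePreserving_eval (fun _ : ι => ν) i).lintegral_comp ((hρ i).indicator (hs i))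

/-- Expanding `(y - a)²` in the Gaussian exponent isolates the tilt `(a y - a² / 2) / v`. -/
theorem gaussianReal_eq_withDensity (a : ℝ) {v : NNReal} (hv : v ≠ 0) :
    gaussianReal a v = (gaussianReal 0 v).withDensity
      fun y => ENNReal.ofReal (Real.exp ((a * y - a ^ 2 / 2) / v)) := by
  rw [gaussianReal_of_var_ne_zero _ hv, gaussianReal_of_var_ne_zero _ hv,
    ← withDensity_mul _ (measurable_gaussianPDF 0 v) (by fun_prop)]
  congr 1
  ext y
  have hv' : (v : ℝ) ≠ 0 := by exact_mod_cast hv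
  rw [Pi.mul_apply, gaussianPDF, gaussianPDF, ← ENNReal.ofReal_mul (gaussianPDFReal_nonneg _ _ _),
    gaussianPDFReal, gaussianPDFReal, mul_assoc _ (Real.exp _), ← Real.exp_add]
  congr 3
  field_simp
  ring

/-- The likelihood ratio between the shift by `a` of a centred Gaussian vector with independent
coordinates of variance `v` and the vector itself. -/
noncomputable def gaussianShiftDensity {ι : Type*} [Fintype ι] (v : NNReal) (a w : ι → ℝ) : ℝ :=
  Real.exp ((∑ i, a i * w i - (∑ i, a i ^ 2) / 2) / v)

section Gaussian

variable {ι : Type*} [Fintype ι] {v : NNReal}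

theorem measurable_gaussianShiftDensity (a : ι → ℝ) :
    Measurable (gaussianShiftDensity v a) := by
  unfold gaussianShiftDensity
  fun_prop

theorem pi_gaussianReal_map_add (hv : v ≠ 0) (a : ι → ℝ) :
    (Measure.pi fun _ : ι => gaussianReal 0 v).map (fun w => w + a) =
      (Measure.pi fun _ : ι => gaussianReal 0 v).withDensity
        fun w => ENNReal.ofReal (gaussianShiftDensity v a w) := by
  have h1 : (Measure.pi fun _ : ι => gaussianReal 0 v).map (fun w => w + a) =
      Measure.pi fun i => gaussianReal (a i) v := by
    have h2 : ∀ i, (gaussianReal 0 v).map (fun y => y + a i) = gaussianReal (a i) v := fun i => by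
      simpa using gaussianReal_map_add_const (μ := 0) (v := v) (a i)
    have : ∀ i, SigmaFinite ((gaussianReal 0 v).map fun y => y + a i) := fun i => by
      rw [h2]; infer_instance
    have := Measure.pi_map_pi (μ := fun _ : ι => gaussianReal 0 v)
      (f := fun (i : ι) (y : ℝ) => y + a i) (fun i => by fun_prop)
    simp only [h2] at this
    exact this
  have : ∀ i, IsProbabilityMeasure ((gaussianReal 0 v).withDensity
      fun y => ENNReal.ofReal (Real.exp ((a i * y - a i ^ 2 / 2) / v))) := fun i => by
    rw [← gaussianReal_eq_withDensity (a i) hv]; infer_instance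
  have h3 := pi_withDensity (gaussianReal 0 v)
    (fun (i : ι) y => ENNReal.ofReal (Real.exp ((a i * y - a i ^ 2 / 2) / v)))
    (fun i => by fun_prop)
  simp only [← gaussianReal_eq_withDensity _ hv] at h3
  rw [h1, h3]
  congr 1
  ext w
  rw [← ENNReal.ofReal_prod_of_nonneg fun i _ => (Real.exp_pos _).le, ← Real.exp_sum,
    gaussianShiftDensity, ← Finset.sum_div, Finset.sum_sub_distrib, Finset.sum_div]

theorem integral_comp_add_pi_gaussianReal (hv : v ≠ 0) (a : ι → ℝ) {f : (ι → ℝ) → ℝ}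
    (hf : Measurable f) :
    ∫ w, f (w + a) ∂(Measure.pi fun _ : ι => gaussianReal 0 v) =
      ∫ w, gaussianShiftDensity v a w * f w ∂(Measure.pi fun _ : ι => gaussianReal 0 v) := by
  rw [← integral_map (φ := fun w : ι → ℝ => w + a) (by fun_prop) hf.aestronglyMeasurable,
    pi_gaussianReal_map_add hv,
    integral_withDensity_eq_integral_toReal_smul
      (measurable_gaussianShiftDensity a).ennreal_ofReal (by simp)]
  refine integral_congr_ae (.of_forall fun w => ?_)
  simp [ENNReal.toReal_ofReal (Real.exp_pos _).le, gaussianShiftDensity]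

theorem integrable_gaussianShiftDensity (hv : v ≠ 0) (a : ι → ℝ) :
    Integrable (gaussianShiftDensity v a) (Measure.pi fun _ : ι => gaussianReal 0 v) := by
  refine ⟨(measurable_gaussianShiftDensity a).aestronglyMeasurable, ?_⟩
  have h1 : ∫⁻ w, ENNReal.ofReal (gaussianShiftDensity v a w)
      ∂(Measure.pi fun _ : ι => gaussianReal 0 v) = 1 := by
    have := congrArg (fun m => m Set.univ) (pi_gaussianReal_map_add hv a)
    simp only [withDensity_apply _ MeasurableSet.univ, Measure.restrict_univ] at this
    rw [← this, Measure.map_apply (by fun_prop) MeasurableSet.univ]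
    simp
  have h0 : ∀ w, 0 ≤ gaussianShiftDensity v a w := fun w => (Real.exp_pos _).le
  rw [hasFiniteIntegral_iff_ofReal (.of_forall h0), h1]
  exact ENNReal.one_lt_top

theorem integral_gaussianShiftDensity (hv : v ≠ 0) (a : ι → ℝ) :
    ∫ w, gaussianShiftDensity v a w ∂(Measure.pi fun _ : ι => gaussianReal 0 v) = 1 := by
  have := integral_comp_add_pi_gaussianReal hv a (f := fun _ => 1) measurable_const
  simpa using this.symm

/-- Squaring doubles the shift up to a constant, so the second moment reduces to the total mass of
another shift density, which is one. -/
theorem gaussianShiftDensity_sq (a w : ι → ℝ) :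
    gaussianShiftDensity v a w ^ 2 =
      Real.exp ((∑ i, a i ^ 2) / v) * gaussianShiftDensity v ((2 : ℝ) • a) w := by
  rw [gaussianShiftDensity, gaussianShiftDensity, ← Real.exp_nat_mul, ← Real.exp_add]
  congr 1
  simp only [Pi.smul_apply, smul_eq_mul, mul_pow, mul_assoc, ← Finset.mul_sum]
  push_cast
  ring

theorem memLp_gaussianShiftDensity (hv : v ≠ 0) (a : ι → ℝ) :
    MemLp (gaussianShiftDensity v a) 2 (Measure.pi fun _ : ι => gaussianReal 0 v) := by
  rw [memLp_two_iff_integrable_sq (measurable_gaussianShiftDensity a).aestronglyMeasurable]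
  simp only [gaussianShiftDensity_sq]
  exact (integrable_gaussianShiftDensity hv _).const_mul _

/-- The chi-square divergence of the shifted law from the centred one. For small shifts it behaves
like `|a|² / v`, the Fisher information term. -/
theorem integral_gaussianShiftDensity_sub_one_sq (hv : v ≠ 0) (a : ι → ℝ) :
    ∫ w, (gaussianShiftDensity v a w - 1) ^ 2 ∂(Measure.pi fun _ : ι => gaussianReal 0 v) =
      Real.exp ((∑ i, a i ^ 2) / v) - 1 := by
  have h1 := integrable_gaussianShiftDensity hv a
  have h2 := (integrable_gaussianShiftDensity hv ((2 : ℝ) • a)).const_mul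
    (Real.exp ((∑ i, a i ^ 2) / v))
  have : ∀ w, (gaussianShiftDensity v a w - 1) ^ 2 =
      Real.exp ((∑ i, a i ^ 2) / v) * gaussianShiftDensity v ((2 : ℝ) • a) w
        - 2 * gaussianShiftDensity v a w + 1 := fun w => by
    rw [← gaussianShiftDensity_sq]; ring
  have h3 : Integrable (fun w => Real.exp ((∑ i, a i ^ 2) / v) *
      gaussianShiftDensity v ((2 : ℝ) • a) w - 2 * gaussianShiftDensity v a w)
      (Measure.pi fun _ : ι => gaussianReal 0 v) := h2.sub (h1.const_mul 2)
  simp only [this]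
  rw [integral_add h3 (integrable_const 1),
    integral_sub h2 (h1.const_mul 2), integral_const_mul, integral_const_mul,
    integral_gaussianShiftDensity hv, integral_gaussianShiftDensity hv]
  simp
  ring

/-- The Hammersley–Chapman–Robbins inequality for the Gaussian shift family. -/
theorem sq_le_mul_exp_sub_one (hv : v ≠ 0) (a : ι → ℝ) {f : (ι → ℝ) → ℝ} (hf : Measurable f)
    (hf2 : MemLp f 2 (Measure.pi fun _ : ι => gaussianReal 0 v)) {d : ℝ}
    (hf0 : ∫ w, f w ∂(Measure.pi fun _ : ι => gaussianReal 0 v) = 0)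
    (hfa : ∫ w, f (w + a) ∂(Measure.pi fun _ : ι => gaussianReal 0 v) = d) :
    d ^ 2 ≤ (∫ w, f w ^ 2 ∂(Measure.pi fun _ : ι => gaussianReal 0 v)) *
      (Real.exp ((∑ i, a i ^ 2) / v) - 1) := by
  set ν := Measure.pi fun _ : ι => gaussianReal 0 v
  have hL : MemLp (fun w => gaussianShiftDensity v a w - 1) 2 ν :=
    (memLp_gaussianShiftDensity hv a).sub (memLp_const 1)
  have hfi : Integrable f ν := hf2.integrable (by norm_num)
  have hLf : Integrable (fun w => gaussianShiftDensity v a w * f w) ν :=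
    (memLp_gaussianShiftDensity hv a).integrable_mul hf2
  have hmul : ∫ w, (gaussianShiftDensity v a w - 1) * f w ∂ν = d := by
    simp only [sub_mul, one_mul]
    rw [integral_sub hLf hfi, ← integral_comp_add_pi_gaussianReal hv a hf, hfa, hf0, sub_zero]
  -- Cauchy–Schwarz for `f` and the centred likelihood ratio, by the discriminant of a nonnegative
  -- quadratic in `s`.
  have hquad : ∀ s : ℝ, 0 ≤ (Real.exp ((∑ i, a i ^ 2) / v) - 1) * (s * s) + (-2 * d) * s +
      ∫ w, f w ^ 2 ∂ν := fun s => by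
    have h0 : 0 ≤ ∫ w, (f w - s * (gaussianShiftDensity v a w - 1)) ^ 2 ∂ν :=
      integral_nonneg fun w => sq_nonneg _
    have h1 : ∀ w, (f w - s * (gaussianShiftDensity v a w - 1)) ^ 2 =
        (s * s) * (gaussianShiftDensity v a w - 1) ^ 2 +
          (-2 * s) * ((gaussianShiftDensity v a w - 1) * f w) + f w ^ 2 := fun w => by ring
    have h2 : Integrable (fun w => (s * s) * (gaussianShiftDensity v a w - 1) ^ 2) ν :=
      hL.integrable_sq.const_mul _
    have h3 : Integrable
        (fun w => (-2 * s) * ((gaussianShiftDensity v a w - 1) * f w)) ν :=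
      (hL.integrable_mul hf2).const_mul _
    have h4 : Integrable (fun w => (s * s) * (gaussianShiftDensity v a w - 1) ^ 2 +
        (-2 * s) * ((gaussianShiftDensity v a w - 1) * f w)) ν := h2.add h3
    simp only [h1] at h0
    rw [integral_add h4 hf2.integrable_sq, integral_add h2 h3, integral_const_mul,
      integral_const_mul, integral_gaussianShiftDensity_sub_one_sq hv, hmul] at h0
    linarith
  have := discrim_le_zero hquad
  rw [discrim] at this
  nlinarith

/-- The Cramér–Rao inequality for the mean of a Gaussian vector along the line spanned by `c`:
unbiasedness along a sequence of parameters suffices. -/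
theorem gaussian_cramer_rao (hv : v ≠ 0) (c : ι → ℝ) {f : (ι → ℝ) → ℝ} (hf : Measurable f)
    (hf0 : ∫ w, f w ∂(Measure.pi fun _ : ι => gaussianReal 0 v) = 0)
    (hfn : ∀ n : ℕ, ∫ w, f (w + ((1 : ℝ) / (n + 1)) • c)
      ∂(Measure.pi fun _ : ι => gaussianReal 0 v) = 1 / (n + 1)) :
    ENNReal.ofReal v / ENNReal.ofReal (∑ i, c i ^ 2) ≤
      ∫⁻ w, ENNReal.ofReal (f w ^ 2) ∂(Measure.pi fun _ : ι => gaussianReal 0 v) := by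
  set ν := Measure.pi fun _ : ι => gaussianReal 0 v
  by_cases hfin : ∫⁻ w, ENNReal.ofReal (f w ^ 2) ∂ν = ∞
  · rw [hfin]; exact le_top
  have hv' : (0 : ℝ) < v := by positivity
  have hsq : Integrable (fun w => f w ^ 2) ν := by
    refine ⟨(hf.pow_const 2).aestronglyMeasurable, ?_⟩
    rw [hasFiniteIntegral_iff_ofReal (.of_forall fun w => sq_nonneg _)]
    exact lt_top_iff_ne_top.2 hfin
  have hf2 : MemLp f 2 ν := (memLp_two_iff_integrable_sq hf.aestronglyMeasurable).2 hsq
  rw [← ofReal_integral_eq_lintegral_ofReal hsq (.of_forall fun w => sq_nonneg _)]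
  set V := ∫ w, f w ^ 2 ∂ν
  set k : ℝ := (∑ i, c i ^ 2) / v with hk
  have hV : 0 ≤ V := integral_nonneg fun w => sq_nonneg _
  have hk0 : 0 ≤ k := by positivity
  have hδ : Filter.Tendsto (fun n : ℕ => (1 : ℝ) / (n + 1)) Filter.atTop (nhds 0) :=
    tendsto_one_div_add_atTop_nhds_zero_nat
  -- The Hammersley–Chapman–Robbins bound for the shift `δ c` is divided by `δ²`, and `δ = 1 / (n +
  -- 1)` tends to zero. The estimate `exp z - 1 ≤ z + z²` for `|z| ≤ 1` controls the remainder.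
  have hone : 1 ≤ V * k := by
    have hlim : Filter.Tendsto (fun n : ℕ => V * (k + k ^ 2 * ((1 : ℝ) / (n + 1)) ^ 2))
        Filter.atTop (nhds (V * (k + k ^ 2 * 0 ^ 2))) :=
      ((((hδ.pow 2).const_mul _).const_add _).const_mul _)
    have hsmall : ∀ᶠ n : ℕ in Filter.atTop, ((1 : ℝ) / (n + 1)) ^ 2 * k < 1 := by
      have := ((hδ.pow 2).mul_const k)
      refine this.eventually_lt_const ?_
      simp
    have := ge_of_tendsto hlim (b := 1) ?_
    · simpa using this
    filter_upwards [hsmall] with n hn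
    set δ : ℝ := 1 / (n + 1) with hδn
    have hδ0 : 0 < δ := by positivity
    have h1 := sq_le_mul_exp_sub_one hv (δ • c) hf hf2 hf0 (hfn n)
    have h2 : (∑ i, (δ • c) i ^ 2) / (v : ℝ) = δ ^ 2 * k := by
      simp only [Pi.smul_apply, smul_eq_mul, mul_pow, ← Finset.mul_sum, hk]
      ring
    rw [h2] at h1
    have h3 : |δ ^ 2 * k| ≤ 1 := by
      rw [abs_of_nonneg (by positivity)]; exact hn.le
    have h4 := (abs_le.1 (Real.abs_exp_sub_one_sub_id_le h3)).2
    have h5 : δ ^ 2 ≤ V * (δ ^ 2 * k + (δ ^ 2 * k) ^ 2) :=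
      h1.trans (mul_le_mul_of_nonneg_left (by linarith) hV)
    have h6 : δ ^ 2 * 1 ≤ δ ^ 2 * (V * (k + k ^ 2 * δ ^ 2)) := by
      calc δ ^ 2 * 1 = δ ^ 2 := mul_one _
        _ ≤ _ := h5
        _ = _ := by ring
    exact le_of_mul_le_mul_left h6 (by positivity)
  -- With `c = 0` the data carry no information, so `k = 0`, which contradicts `1 ≤ V * k`.
  have hu : 0 < ∑ i, c i ^ 2 := by
    rcases (Finset.sum_nonneg fun i _ => sq_nonneg (c i) : 0 ≤ ∑ i, c i ^ 2).lt_or_eq with h | h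
    · exact h
    · rw [hk, ← h] at hone
      simp at hone
      linarith
  rw [← ENNReal.ofReal_div_of_pos hu]
  refine ENNReal.ofReal_le_ofReal ?_
  rw [hk, mul_div_assoc', le_div_iff₀ hv', one_mul] at hone
  rwa [div_le_iff₀ hu]

end Gaussian

/-! ### Linear forms in i.i.d. noise and the Gauss–Markov inequality. -/

section Linear

variable {ι : Type*} [Fintype ι] {ν : Measure ℝ} [IsProbabilityMeasure ν]

theorem memLp_sum_mul_eval (hν : MemLp id 2 ν) (a : ι → ℝ) :
    MemLp (fun w : ι → ℝ => ∑ i, a i * w i) 2 (Measure.pi fun _ : ι => ν) :=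
  memLp_finsetSum _ fun i _ =>
    (hν.comp_measurePreserving (measurePreserving_eval (fun _ : ι => ν) i)).const_mul (a i)

theorem integral_sum_mul_eval (hν : MemLp id 2 ν) (hmean : ∫ y, y ∂ν = 0) (a : ι → ℝ) :
    ∫ w, ∑ i, a i * w i ∂(Measure.pi fun _ : ι => ν) = 0 := by
  have hi : ∀ i : ι, Integrable (fun w : ι → ℝ => w i) (Measure.pi fun _ : ι => ν) := fun i =>
    (hν.comp_measurePreserving (measurePreserving_eval (fun _ : ι => ν) i)).integrable
      (by norm_num)
  rw [integral_finsetSum _ fun i _ => (hi i).const_mul (a i)]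
  refine Finset.sum_eq_zero fun i _ => ?_
  rw [integral_const_mul]
  have := integral_comp_eval (μ := fun _ : ι => ν) (i := i) (f := fun y : ℝ => y)
    aestronglyMeasurable_id
  rw [this, hmean, mul_zero]

theorem lintegral_sum_mul_eval_sq {σ : ℝ} (hν : MemLp id 2 ν) (hmean : ∫ y, y ∂ν = 0)
    (hvar : variance id ν = σ ^ 2) (a : ι → ℝ) :
    ∫⁻ w, ENNReal.ofReal ((∑ i, a i * w i) ^ 2) ∂(Measure.pi fun _ : ι => ν) =
      ENNReal.ofReal (σ ^ 2 * ∑ i, a i ^ 2) := by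
  have h1 := memLp_sum_mul_eval hν a
  rw [← ofReal_integral_eq_lintegral_ofReal h1.integrable_sq (.of_forall fun w => sq_nonneg _),
    ← variance_of_integral_eq_zero h1.aemeasurable (integral_sum_mul_eval hν hmean a)]
  have h2 := variance_sum_pi (μ := fun _ : ι => ν) (X := fun i y => a i * y)
    (fun i => hν.const_mul (a i))
  have h3 : (∑ i, fun w : ι → ℝ => a i * w i) = fun w => ∑ i, a i * w i := by
    ext w; simp
  rw [h3] at h2
  rw [h2, Finset.mul_sum]
  congr 1
  refine Finset.sum_congr rfl fun i _ => ?_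
  rw [variance_const_mul]
  change a i ^ 2 * variance id ν = _
  rw [hvar]
  ring

/-- The Gauss–Markov inequality. -/
theorem gauss_markov {σ : ℝ} (a c : ι → ℝ) (hac : ∑ i, a i * c i = 1) :
    ENNReal.ofReal (σ ^ 2) / ENNReal.ofReal (∑ i, c i ^ 2) ≤
      ENNReal.ofReal (σ ^ 2 * ∑ i, a i ^ 2) := by
  have hcs := Finset.sum_mul_sq_le_sq_mul_sq Finset.univ a c
  rw [hac, one_pow] at hcs
  have hu : 0 < ∑ i, c i ^ 2 := by
    refine lt_of_le_of_ne (Finset.sum_nonneg fun i _ => sq_nonneg _) fun h => ?_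
    rw [← h, mul_zero] at hcs
    linarith
  rw [← ENNReal.ofReal_div_of_pos hu]
  refine ENNReal.ofReal_le_ofReal ?_
  rw [div_le_iff₀ hu, mul_assoc]
  exact le_mul_of_one_le_right (sq_nonneg σ) hcs

end Linear

end SeqEst

/-! ### Disintegration of the stopped data, variance bounds, and least squares. -/

namespace SeqEst

variable {Ω : Type*}

/-- The vector of the first `t` terms of a sequence of random variables. -/
def initial (f : ℕ → Ω → ℝ) (t : ℕ) (ω : Ω) : Fin t → ℝ := fun i => f i ω

theorem energy_eq_sum_initial (h : ℕ → Ω → ℝ) (t : ℕ) (ω : Ω) :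
    energy h t ω = ∑ i, initial h t ω i ^ 2 :=
  (Fin.sum_univ_eq_sum_range (fun i => h i ω ^ 2) t).symm

theorem estimate_of_eq {h w : ℕ → Ω → ℝ} {T : Ω → WithTop ℕ} (x : ℝ) (φ : Estimator) {t : ℕ}
    {ω : Ω} (hT : T ω = WithTop.some t) :
    estimate h w x T φ ω =
      φ t (initial h t ω, fun i => initial h t ω i * x + initial w t ω i) := by
  unfold estimate
  rw [hT]
  rfl

variable [MeasurableSpace Ω] {P : Measure Ω} {h w : ℕ → Ω → ℝ}

theorem measurable_initial {f : ℕ → Ω → ℝ} (hf : ∀ i, Measurable (f i)) (t : ℕ) :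
    Measurable (initial f t) :=
  measurable_pi_lambda _ fun i => hf i

theorem coeffFiltration_eq_comap (hh : ∀ i, Measurable (h i)) (t : ℕ) :
    coeffFiltration h hh t = MeasurableSpace.comap (initial h t) MeasurableSpace.pi := by
  change (⨆ i : ℕ, ⨆ _ : i < t, MeasurableSpace.comap (h i) inferInstance) = _
  rw [MeasurableSpace.pi, MeasurableSpace.comap_iSup]
  simp only [MeasurableSpace.comap_comp]
  refine le_antisymm (iSup_le fun i => iSup_le fun hi => ?_) (iSup_le fun i => ?_)
  · exact le_iSup_of_le (⟨i, hi⟩ : Fin t) le_rfl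
  · exact le_iSup_of_le (i : ℕ) (le_iSup_of_le i.2 le_rfl)

theorem measurableSet_coeffFiltration_iff (hh : ∀ i, Measurable (h i)) (t : ℕ) (s : Set Ω) :
    MeasurableSet[coeffFiltration h hh t] s ↔ ∃ B, MeasurableSet B ∧ initial h t ⁻¹' B = s := by
  rw [coeffFiltration_eq_comap]
  exact Iff.rfl

/-- The Borel sets `S t` describe stopping inside `ℝ^t`; integrals of stopped quantities become sums
over `t` of integrals over `S t`. -/
theorem exists_preimage_eq_stopping {hh : ∀ i, Measurable (h i)} {T : Ω → WithTop ℕ}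
    (hT : IsStoppingTime (coeffFiltration h hh) T) :
    ∃ S : (t : ℕ) → Set (Fin t → ℝ), (∀ t, MeasurableSet (S t)) ∧
      ∀ t : ℕ, initial h t ⁻¹' S t = {ω | T ω = WithTop.some t} := by
  have := fun t : ℕ => (measurableSet_coeffFiltration_iff hh t _).1
    (hT.measurableSet_eq_of_countable t)
  choose S hS hST using this
  exact ⟨S, hS, hST⟩

/-- All independence involving the noise is condensed into this product law, the form in which the
later arguments use it. -/
theorem map_initial_prod [IsProbabilityMeasure P] (hh : ∀ i, Measurable (h i))
    (hw : ∀ i, Measurable (w i)) (hw_indep : iIndepFun w P)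
    (hw_ident : ∀ i, IdentDistrib (w i) (w 0) P P)
    (hhw : IndepFun (fun ω i => h i ω) (fun ω i => w i ω) P) (t : ℕ) :
    P.map (fun ω => (initial h t ω, initial w t ω)) =
      (P.map (initial h t)).prod (Measure.pi fun _ : Fin t => P.map (w 0)) := by
  have hr : Measurable fun (s : ℕ → ℝ) (i : Fin t) => s i :=
    measurable_pi_lambda _ fun i => measurable_pi_apply _
  have h1 : IndepFun (initial h t) (initial w t) P := hhw.comp hr hr
  rw [h1.map_prod_eq_prod_map_map (measurable_initial hh t).aemeasurable
    (measurable_initial hw t).aemeasurable]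
  congr 1
  have h2 : iIndepFun (fun i : Fin t => w i) P := hw_indep.precomp Fin.val_injective
  have h3 := (iIndepFun_iff_map_fun_eq_pi_map fun i : Fin t => (hw i).aemeasurable).1 h2
  simp only [(hw_ident _).map_eq] at h3
  exact h3

section Stopped

variable {ν : Measure ℝ} [IsProbabilityMeasure ν] {T : Ω → WithTop ℕ}
  {S : (t : ℕ) → Set (Fin t → ℝ)}

theorem lintegral_eq_tsum_stopped {T : Ω → WithTop ℕ}
    (hTm : ∀ t : ℕ, MeasurableSet {ω | T ω = WithTop.some t}) (hfin : ∀ᵐ ω ∂P, T ω ≠ ⊤) (F : Ω → ℝ≥0∞) :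
    ∫⁻ ω, F ω ∂P = ∑' t : ℕ, ∫⁻ ω in {ω | T ω = WithTop.some t}, F ω ∂P := by
  have hdisj : Pairwise (Function.onFun Disjoint fun t : ℕ => {ω | T ω = WithTop.some t}) := fun s t hst =>
    Set.disjoint_left.2 fun ω (hs : T ω = WithTop.some s) (ht : T ω = WithTop.some t) => hst (by
      have := hs.symm.trans ht
      exact WithTop.coe_injective this)
  rw [← lintegral_iUnion hTm hdisj, ← setLIntegral_univ]
  refine setLIntegral_congr ?_
  filter_upwards [hfin] with ω hω
  obtain ⟨t, ht⟩ := WithTop.ne_top_iff_exists.1 hω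
  have h1 : ω ∈ ⋃ t : ℕ, {ω | T ω = WithTop.some t} := Set.mem_iUnion.2 ⟨t, ht.symm⟩
  exact propext ⟨fun _ => h1, fun _ => trivial⟩

/-- A nonnegative functional of the stopped data, integrated over the law of the data. -/
theorem lintegral_stopped [IsProbabilityMeasure P] (hh : ∀ i, Measurable (h i)) (hw : ∀ i, Measurable (w i))
    (hlaw : ∀ t, P.map (fun ω => (initial h t ω, initial w t ω)) =
      (P.map (initial h t)).prod (Measure.pi fun _ : Fin t => ν))
    (hS : ∀ t, MeasurableSet (S t)) (hST : ∀ t : ℕ, initial h t ⁻¹' S t = {ω | T ω = WithTop.some t})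
    (hfin : ∀ᵐ ω ∂P, T ω ≠ ⊤) {g : (t : ℕ) → (Fin t → ℝ) × (Fin t → ℝ) → ℝ≥0∞}
    (hg : ∀ t, Measurable (g t)) {F : Ω → ℝ≥0∞}
    (hF : ∀ (t : ℕ) ω, T ω = WithTop.some t → F ω = g t (initial h t ω, initial w t ω)) :
    ∫⁻ ω, F ω ∂P = ∑' t : ℕ, ∫⁻ c in S t, ∫⁻ e, g t (c, e) ∂(Measure.pi fun _ : Fin t => ν)
      ∂(P.map (initial h t)) := by
  have hTm : ∀ t : ℕ, MeasurableSet {ω | T ω = WithTop.some t} := fun t =>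
    hST t ▸ measurable_initial hh t (hS t)
  rw [lintegral_eq_tsum_stopped hTm hfin]
  refine tsum_congr fun t => ?_
  have : IsProbabilityMeasure (P.map (initial h t)) :=
    Measure.isProbabilityMeasure_map (measurable_initial hh t).aemeasurable
  have hmeas : Measurable fun ω => (initial h t ω, initial w t ω) :=
    (measurable_initial hh t).prodMk (measurable_initial hw t)
  have hpre : {ω | T ω = WithTop.some t} = (fun ω => (initial h t ω, initial w t ω)) ⁻¹' (S t ×ˢ Set.univ) := by
    rw [← hST t]; ext ω; simp
  rw [setLIntegral_congr_fun (hTm t) fun ω hω => hF t ω hω, hpre,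
    ← setLIntegral_map ((hS t).prod MeasurableSet.univ) (hg t) hmeas, hlaw t,
    ← Measure.prod_restrict, Measure.restrict_univ, lintegral_prod _ (hg t).aemeasurable]

theorem measurable_untopD (hTm : ∀ t : ℕ, MeasurableSet {ω | T ω = WithTop.some t}) :
    Measurable fun ω => (T ω).untopD 0 := by
  refine measurable_to_nat fun ω => ?_
  -- The default sends `⊤` to `0`, so the fibre over `0` contains `{T = ⊤}` and is obtained as the
  -- complement of the positive finite levels.
  by_cases hω : (T ω).untopD 0 = 0
  · have : (fun ω => (T ω).untopD 0) ⁻¹' {(T ω).untopD 0} =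
        (⋃ t : ℕ, {ω | T ω = WithTop.some (t + 1)})ᶜ := by
      ext ω'
      simp only [hω, Set.mem_preimage, Set.mem_singleton_iff, Set.mem_compl_iff, Set.mem_iUnion,
        Set.mem_ofPred_eq, not_exists]
      cases hT : T ω' with
      | top => exact ⟨fun _ t => WithTop.top_ne_coe, fun _ => rfl⟩
      | coe n =>
        rw [WithTop.untopD_coe]
        exact ⟨fun h0 t ht => by have := WithTop.coe_injective ht; lia,
          fun h0 => by_contra fun hn => h0 (n - 1) (congrArg WithTop.some (by lia))⟩
    rw [this]
    exact (MeasurableSet.iUnion fun t => hTm (t + 1)).compl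
  · have : (fun ω => (T ω).untopD 0) ⁻¹' {(T ω).untopD 0} =
        {ω' | T ω' = WithTop.some ((T ω).untopD 0)} := by
      ext ω'
      simp only [Set.mem_preimage, Set.mem_singleton_iff, Set.mem_ofPred_eq]
      cases hT : T ω' with
      | top => exact ⟨fun h0 => absurd h0.symm hω, fun h0 => absurd h0 WithTop.top_ne_coe⟩
      | coe n =>
        rw [WithTop.untopD_coe]
        exact ⟨fun h0 => congrArg WithTop.some h0, fun h0 => WithTop.coe_injective h0⟩
    rw [this]
    exact hTm _

theorem measurable_estimate (hh : ∀ i, Measurable (h i)) (hw : ∀ i, Measurable (w i))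
    (hTm : ∀ t : ℕ, MeasurableSet {ω | T ω = WithTop.some t}) {φ : Estimator} (hφ : ∀ t, Measurable (φ t))
    (x : ℝ) : Measurable (estimate h w x T φ) := by
  have hF : ∀ t : ℕ, Measurable fun ω =>
      φ t (fun i => h i ω, fun i => h i ω * x + w i ω) := fun t => by
    refine (hφ t).comp (Measurable.prodMk ?_ ?_)
    · exact measurable_pi_lambda _ fun i => hh i
    · exact measurable_pi_lambda _ fun i => ((hh i).mul_const x).add (hw i)
  have : Measurable fun p : ℕ × Ω => φ p.1 (fun i => h i p.2, fun i => h i p.2 * x + w i p.2) :=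
    measurable_from_prod_countable_right hF
  exact this.comp ((measurable_untopD hTm).prodMk measurable_id)

theorem IsAdmissible.integral_estimate [IsProbabilityMeasure P] {hh : ∀ i, Measurable (h i)}
    {φ : Estimator} (hadm : IsAdmissible P h w hh T φ) (x : ℝ) :
    ∫ ω, estimate h w x T φ ω ∂P = x := by
  rw [← integral_condExp hadm.stopping.measurableSpace_le, integral_congr_ae (hadm.unbiased x)]
  simp

theorem measurable_observation (t : ℕ) {φ : Estimator} (hφ : ∀ t, Measurable (φ t)) (x : ℝ) :
    Measurable fun p : (Fin t → ℝ) × (Fin t → ℝ) => φ t (p.1, fun i => p.1 i * x + p.2 i) := by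
  refine (hφ t).comp (measurable_fst.prodMk (measurable_pi_lambda _ fun i => ?_))
  fun_prop

/-- Unbiasedness given the stopped coefficients holds for almost every value of them. -/
theorem IsAdmissible.ae_integral_eq [IsProbabilityMeasure P] {hh : ∀ i, Measurable (h i)}
    {φ : Estimator} (hadm : IsAdmissible P h w hh T φ) (hw : ∀ i, Measurable (w i))
    (hlaw : ∀ t, P.map (fun ω => (initial h t ω, initial w t ω)) =
      (P.map (initial h t)).prod (Measure.pi fun _ : Fin t => ν))
    (hS : ∀ t, MeasurableSet (S t)) (hST : ∀ t : ℕ, initial h t ⁻¹' S t = {ω | T ω = WithTop.some t})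
    (t : ℕ) (x : ℝ) :
    ∀ᵐ c ∂(P.map (initial h t)), c ∈ S t →
      Integrable (fun e => φ t (c, fun i => c i * x + e i)) (Measure.pi fun _ : Fin t => ν) ∧
      ∫ e, φ t (c, fun i => c i * x + e i) ∂(Measure.pi fun _ : Fin t => ν) = x := by
  have hH := measurable_initial hh t
  have : IsProbabilityMeasure (P.map (initial h t)) :=
    Measure.isProbabilityMeasure_map hH.aemeasurable
  have hTm : MeasurableSet {ω | T ω = WithTop.some t} := hST t ▸ hH (hS t)
  have hmeas : Measurable fun ω => (initial h t ω, initial w t ω) :=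
    hH.prodMk (measurable_initial hw t)
  set g := fun p : (Fin t → ℝ) × (Fin t → ℝ) => φ t (p.1, fun i => p.1 i * x + p.2 i) with hg_def
  have hg : Measurable g := measurable_observation t hadm.measurable x
  -- Cutting off outside `S t` keeps only the event `{T = t}`, where the integrand is the stopped
  -- estimate and integrability is known.
  set F := (S t ×ˢ (Set.univ : Set (Fin t → ℝ))).indicator g with hF_def
  have hSm : MeasurableSet (S t ×ˢ (Set.univ : Set (Fin t → ℝ))) := (hS t).prod MeasurableSet.univ
  have hFm : Measurable F := hg.indicator hSm
  have hcomp : (fun ω => F (initial h t ω, initial w t ω)) =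
      {ω | T ω = WithTop.some t}.indicator (estimate h w x T φ) := by
    ext ω
    by_cases hω : T ω = WithTop.some t
    · have h1 : initial h t ω ∈ S t := by
        have : ω ∈ initial h t ⁻¹' S t := by rw [hST t]; exact hω
        exact this
      rw [Set.indicator_of_mem (by exact hω), estimate_of_eq x φ hω, hF_def,
        Set.indicator_of_mem (by simpa using h1)]
    · have h1 : initial h t ω ∉ S t := fun h2 => hω (by
        have : ω ∈ initial h t ⁻¹' S t := h2
        rwa [hST t] at this)
      rw [Set.indicator_of_notMem (by exact hω), hF_def,
        Set.indicator_of_notMem (by simpa using h1)]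
  have hFint : Integrable F ((P.map (initial h t)).prod (Measure.pi fun _ : Fin t => ν)) := by
    rw [← hlaw t, integrable_map_measure hFm.aestronglyMeasurable hmeas.aemeasurable]
    change Integrable (fun ω => F (initial h t ω, initial w t ω)) P
    rw [hcomp]
    exact (hadm.integrable x).indicator hTm
  have hae : (fun c => ∫ e, F (c, e) ∂(Measure.pi fun _ : Fin t => ν)) =ᵐ[P.map (initial h t)]
      (S t).indicator fun _ => x := by
    refine Integrable.ae_eq_of_forall_setIntegral_eq _ _ hFint.integral_prod_left
      ((integrable_const x).indicator (hS t)) fun B hB _ => ?_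
    -- Membership in the stopped σ-algebra on `{T = t}` is membership at time `t`, so the
    -- unbiasedness hypothesis may be integrated over every such set.
    have hBm : MeasurableSet[hadm.stopping.measurableSpace]
        (initial h t ⁻¹' B ∩ {ω | T ω = WithTop.some t}) := by
      rw [hadm.stopping.measurableSet_inter_eq_iff, measurableSet_coeffFiltration_iff]
      exact ⟨B ∩ S t, hB.inter (hS t), by rw [Set.preimage_inter, hST t]⟩
    calc ∫ c in B, ∫ e, F (c, e) ∂(Measure.pi fun _ : Fin t => ν) ∂(P.map (initial h t))
        = ∫ p in B ×ˢ Set.univ, F p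
            ∂((P.map (initial h t)).prod (Measure.pi fun _ : Fin t => ν)) := by
          rw [setIntegral_prod _ hFint.integrableOn]
          simp
      _ = ∫ ω in initial h t ⁻¹' B, F (initial h t ω, initial w t ω) ∂P := by
          rw [← hlaw t, setIntegral_map (hB.prod MeasurableSet.univ) hFm.aestronglyMeasurable
            hmeas.aemeasurable]
          congr 2
          ext ω
          simp
      _ = ∫ ω in initial h t ⁻¹' B ∩ {ω | T ω = WithTop.some t}, estimate h w x T φ ω ∂P := by
          rw [hcomp, setIntegral_indicator hTm]
      _ = ∫ ω in initial h t ⁻¹' B ∩ {ω | T ω = WithTop.some t}, x ∂P := by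
          rw [← setIntegral_condExp hadm.stopping.measurableSpace_le (hadm.integrable x) hBm]
          exact integral_congr_ae (ae_restrict_of_ae (hadm.unbiased x))
      _ = ∫ ω in initial h t ⁻¹' B, (S t).indicator (fun _ => x) (initial h t ω) ∂P := by
          rw [← setIntegral_indicator hTm, ← hST t]
          rfl
      _ = ∫ c in B, (S t).indicator (fun _ => x) c ∂(P.map (initial h t)) :=
          (setIntegral_map hB (measurable_const.indicator (hS t)).aestronglyMeasurable
            hH.aemeasurable).symm
  filter_upwards [hae, hFint.prod_right_ae] with c hc hci hcS
  have h1 : ∀ e, F (c, e) = φ t (c, fun i => c i * x + e i) := fun e => by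
    rw [hF_def, Set.indicator_of_mem (by simpa using hcS)]
  simp only [h1] at hc hci
  exact ⟨hci, by rw [hc, Set.indicator_of_mem hcS]⟩

/-- A lower bound for the conditional variance, for almost every value of the stopped
coefficients, integrates to a lower bound for the variance. -/
theorem IsAdmissible.lintegral_div_energy_le [IsProbabilityMeasure P]
    {hh : ∀ i, Measurable (h i)}
    {φ : Estimator} (hadm : IsAdmissible P h w hh T φ) (hw : ∀ i, Measurable (w i))
    (hlaw : ∀ t, P.map (fun ω => (initial h t ω, initial w t ω)) =
      (P.map (initial h t)).prod (Measure.pi fun _ : Fin t => ν))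
    (hS : ∀ t, MeasurableSet (S t)) (hST : ∀ t : ℕ, initial h t ⁻¹' S t = {ω | T ω = WithTop.some t})
    {x σ : ℝ} (hbound : ∀ t, ∀ᵐ c ∂(P.map (initial h t)), c ∈ S t →
      ENNReal.ofReal (σ ^ 2) / ENNReal.ofReal (∑ i, c i ^ 2) ≤
        ∫⁻ e, ENNReal.ofReal ((φ t (c, fun i => c i * x + e i) - x) ^ 2)
          ∂(Measure.pi fun _ : Fin t => ν)) :
    ∫⁻ ω, ENNReal.ofReal (σ ^ 2) / ENNReal.ofReal (energy h ((T ω).untopD 0) ω) ∂P ≤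
      evariance (estimate h w x T φ) P := by
  rw [evariance_eq_lintegral_ofReal, hadm.integral_estimate x,
    lintegral_stopped hh hw hlaw hS hST hadm.finite
      (g := fun t p => ENNReal.ofReal (σ ^ 2) / ENNReal.ofReal (∑ i, p.1 i ^ 2))
      (fun t => by fun_prop) (fun t ω hω => by rw [hω, ← energy_eq_sum_initial]; rfl),
    lintegral_stopped hh hw hlaw hS hST hadm.finite
      (g := fun t p => ENNReal.ofReal ((φ t (p.1, fun i => p.1 i * x + p.2 i) - x) ^ 2))
      (fun t => (((measurable_observation t hadm.measurable x).sub_const x).pow_const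
        2).ennreal_ofReal)
      (fun t ω hω => by rw [estimate_of_eq x φ hω])]
  refine ENNReal.tsum_le_tsum fun t => lintegral_mono_ae ?_
  rw [ae_restrict_iff' (hS t)]
  filter_upwards [hbound t] with c hc hcS
  simpa using hc hcS

/-- The noise part of a linear estimator has mean zero, so its conditional mean at parameter `z` is
`(∑ a c) z`. Unbiasedness at `z = 1` alone forces `∑ a c = 1`, the constraint of Gauss–Markov. -/
theorem IsAdmissible.lintegral_div_energy_le_of_isLinear [IsProbabilityMeasure P]
    {hh : ∀ i, Measurable (h i)}
    {φ : Estimator} (hadm : IsAdmissible P h w hh T φ) (hφ : φ.IsLinear)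
    (hw : ∀ i, Measurable (w i))
    (hlaw : ∀ t, P.map (fun ω => (initial h t ω, initial w t ω)) =
      (P.map (initial h t)).prod (Measure.pi fun _ : Fin t => ν))
    {σ : ℝ} (hν : MemLp id 2 ν) (hmean : ∫ y, y ∂ν = 0) (hvar : variance id ν = σ ^ 2) (x : ℝ) :
    ∫⁻ ω, ENNReal.ofReal (σ ^ 2) / ENNReal.ofReal (energy h ((T ω).untopD 0) ω) ∂P ≤
      evariance (estimate h w x T φ) P := by
  obtain ⟨S, hS, hST⟩ := exists_preimage_eq_stopping hadm.stopping
  obtain ⟨a, -, hφa⟩ := hφ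
  refine hadm.lintegral_div_energy_le hw hlaw hS hST fun t => ?_
  filter_upwards [hadm.ae_integral_eq hw hlaw hS hST t 1] with c hc hcS
  have hsplit : ∀ z : ℝ, ∀ e : Fin t → ℝ, φ t (c, fun i => c i * z + e i) =
      (∑ i, a t c i * c i) * z + ∑ i, a t c i * e i := fun z e => by
    rw [hφa, Finset.sum_mul, ← Finset.sum_add_distrib]
    exact Finset.sum_congr rfl fun i _ => by ring
  have hac : ∑ i, a t c i * c i = 1 := by
    have h1 := (hc hcS).2
    simp only [hsplit] at h1
    rw [integral_add (integrable_const _)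
        ((memLp_sum_mul_eval hν (a t c)).integrable (by norm_num)),
      integral_sum_mul_eval hν hmean] at h1
    simpa using h1
  simp only [hsplit, hac, one_mul, add_sub_cancel_left]
  rw [lintegral_sum_mul_eval_sq hν hmean hvar]
  exact gauss_markov _ _ hac

/-- The null set of coefficients off which unbiasedness holds depends on the parameter, so only
countably many parameters can be used at once: `x` and `x + 1 / (n + 1)`. Such a change of parameter
shifts the noise by `c / (n + 1)`, which is what `gaussian_cramer_rao` asks for. -/
theorem IsAdmissible.lintegral_div_energy_le_of_gaussian [IsProbabilityMeasure P]
    {hh : ∀ i, Measurable (h i)}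
    {φ : Estimator} (hadm : IsAdmissible P h w hh T φ) (hw : ∀ i, Measurable (w i)) {σ : ℝ}
    (hσ : 0 < σ) (hlaw : ∀ t, P.map (fun ω => (initial h t ω, initial w t ω)) =
      (P.map (initial h t)).prod
        (Measure.pi fun _ : Fin t => gaussianReal 0 (Real.toNNReal (σ ^ 2)))) (x : ℝ) :
    ∫⁻ ω, ENNReal.ofReal (σ ^ 2) / ENNReal.ofReal (energy h ((T ω).untopD 0) ω) ∂P ≤
      evariance (estimate h w x T φ) P := by
  obtain ⟨S, hS, hST⟩ := exists_preimage_eq_stopping hadm.stopping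
  refine hadm.lintegral_div_energy_le hw hlaw hS hST fun t => ?_
  have hn := ae_all_iff.2 fun n : ℕ =>
    hadm.ae_integral_eq hw hlaw hS hST t (x + (1 : ℝ) / (n + 1))
  filter_upwards [hadm.ae_integral_eq hw hlaw hS hST t x, hn] with c hc hcn hcS
  have hv : Real.toNNReal (σ ^ 2) ≠ 0 := by
    rw [Ne, Real.toNNReal_eq_zero, not_le]; positivity
  have hφc : Measurable fun e : Fin t → ℝ => φ t (c, fun i => c i * x + e i) :=
    (measurable_observation t hadm.measurable x).comp measurable_prodMk_left
  have := gaussian_cramer_rao hv c (hφc.sub_const x) ?_ fun n => ?_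
  · rwa [Real.coe_toNNReal _ (sq_nonneg σ)] at this
  · rw [integral_sub (hc hcS).1 (integrable_const x), (hc hcS).2]
    simp
  · have h1 := hcn n hcS
    have h2 : ∀ e : Fin t → ℝ, (fun i => c i * x + (e + ((1 : ℝ) / (n + 1)) • c) i) =
        fun i => c i * (x + 1 / (n + 1)) + e i := fun e => by
      ext i
      simp only [Pi.add_apply, Pi.smul_apply, smul_eq_mul]
      ring
    simp only [h2]
    rw [integral_sub h1.1 (integrable_const x), h1.2]
    simp

theorem isLinear_leastSquares : leastSquares.IsLinear := by
  refine ⟨fun t c i => c i / ∑ j, c j ^ 2, fun t => ?_, fun t c y => ?_⟩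
  · exact measurable_pi_lambda _ fun i => by fun_prop
  · rw [leastSquares, Finset.sum_div]
    exact Finset.sum_congr rfl fun i _ => by ring

theorem measurable_leastSquares (t : ℕ) : Measurable (leastSquares t) := by
  unfold leastSquares
  fun_prop

theorem leastSquares_sub {t : ℕ} {c : Fin t → ℝ} (hc : 0 < ∑ i, c i ^ 2) (x : ℝ)
    (e : Fin t → ℝ) :
    leastSquares t (c, fun i => c i * x + e i) - x = ∑ i, (c i / ∑ j, c j ^ 2) * e i := by
  have h1 : ∑ i, c i * (c i * x + e i) = (∑ i, c i ^ 2) * x + ∑ i, c i * e i := by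
    rw [Finset.sum_mul, ← Finset.sum_add_distrib]
    exact Finset.sum_congr rfl fun i _ => by ring
  have h2 : ∑ i, (c i / ∑ j, c j ^ 2) * e i = (∑ i, c i * e i) / ∑ j, c j ^ 2 := by
    rw [Finset.sum_div]
    exact Finset.sum_congr rfl fun i _ => by ring
  simp only [leastSquares]
  rw [h1, h2]
  field_simp
  ring

/-- The mean squared error of the least squares estimator at a stopping time. -/
theorem lintegral_leastSquares_sub_sq [IsProbabilityMeasure P] (hh : ∀ i, Measurable (h i)) (hw : ∀ i, Measurable (w i))
    (hlaw : ∀ t, P.map (fun ω => (initial h t ω, initial w t ω)) =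
      (P.map (initial h t)).prod (Measure.pi fun _ : Fin t => ν))
    (hS : ∀ t, MeasurableSet (S t)) (hST : ∀ t : ℕ, initial h t ⁻¹' S t = {ω | T ω = WithTop.some t})
    (hfin : ∀ᵐ ω ∂P, T ω ≠ ⊤) (hpos : ∀ t, ∀ c ∈ S t, 0 < ∑ i, c i ^ 2)
    {σ : ℝ} (hν : MemLp id 2 ν) (hmean : ∫ y, y ∂ν = 0) (hvar : variance id ν = σ ^ 2) (x : ℝ) :
    ∫⁻ ω, ENNReal.ofReal ((estimate h w x T leastSquares ω - x) ^ 2) ∂P =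
      ∫⁻ ω, ENNReal.ofReal (σ ^ 2) / ENNReal.ofReal (energy h ((T ω).untopD 0) ω) ∂P := by
  rw [lintegral_stopped hh hw hlaw hS hST hfin
      (F := fun ω => ENNReal.ofReal (σ ^ 2) / ENNReal.ofReal (energy h ((T ω).untopD 0) ω))
      (g := fun t p => ENNReal.ofReal (σ ^ 2) / ENNReal.ofReal (∑ i, p.1 i ^ 2))
      (fun t => by fun_prop) (fun t ω hω => by rw [hω, ← energy_eq_sum_initial]; rfl),
    lintegral_stopped hh hw hlaw hS hST hfin
      (g := fun t p => ENNReal.ofReal ((leastSquares t (p.1, fun i => p.1 i * x + p.2 i) - x) ^ 2))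
      (fun t => (((measurable_observation t measurable_leastSquares x).sub_const x).pow_const
        2).ennreal_ofReal)
      (fun t ω hω => by rw [estimate_of_eq x leastSquares hω])]
  refine tsum_congr fun t => setLIntegral_congr_fun (hS t) fun c hc => ?_
  have hu := hpos t c hc
  simp only [leastSquares_sub hu]
  rw [lintegral_sum_mul_eval_sq hν hmean hvar, ← ENNReal.ofReal_div_of_pos hu]
  simp only [lintegral_const, measure_univ, mul_one]
  congr 1
  simp only [div_pow]
  rw [← Finset.sum_div]
  field_simp

/-- The error is square integrable because `E[σ² / u_T]` is finite. On `A ∩ {T = t}`, with `A` in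
the stopped σ-algebra, it is a linear form in the noise whose weights depend on the coefficients
only, so it integrates to zero; summing over `t` gives the conditional mean. -/
theorem isAdmissible_leastSquares [IsProbabilityMeasure P] {hh : ∀ i, Measurable (h i)}
    (hw : ∀ i, Measurable (w i))
    (hlaw : ∀ t, P.map (fun ω => (initial h t ω, initial w t ω)) =
      (P.map (initial h t)).prod (Measure.pi fun _ : Fin t => ν))
    (hT : IsStoppingTime (coeffFiltration h hh) T)
    (hS : ∀ t, MeasurableSet (S t)) (hST : ∀ t : ℕ, initial h t ⁻¹' S t = {ω | T ω = WithTop.some t})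
    (hfin : ∀ᵐ ω ∂P, T ω ≠ ⊤) (hpos : ∀ t, ∀ c ∈ S t, 0 < ∑ i, c i ^ 2)
    {σ : ℝ} (hν : MemLp id 2 ν) (hmean : ∫ y, y ∂ν = 0) (hvar : variance id ν = σ ^ 2)
    (hlt : ∫⁻ ω, ENNReal.ofReal (σ ^ 2) / ENNReal.ofReal (energy h ((T ω).untopD 0) ω) ∂P < ∞) :
    IsAdmissible P h w hh T leastSquares := by
  have hTm : ∀ t : ℕ, MeasurableSet {ω | T ω = WithTop.some t} := fun t =>
    hST t ▸ measurable_initial hh t (hS t)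
  have hmeas : ∀ x, Measurable (estimate h w x T leastSquares) :=
    measurable_estimate hh hw hTm measurable_leastSquares
  have hint0 : ∀ x, Integrable (fun ω => estimate h w x T leastSquares ω - x) P := fun x => by
    refine MemLp.integrable (q := 2) (by norm_num) ?_
    rw [memLp_two_iff_integrable_sq ((hmeas x).sub_const x).aestronglyMeasurable]
    refine ⟨(((hmeas x).sub_const x).pow_const 2).aestronglyMeasurable, ?_⟩
    rw [hasFiniteIntegral_iff_ofReal (.of_forall fun ω => sq_nonneg _),
      lintegral_leastSquares_sub_sq hh hw hlaw hS hST hfin hpos hν hmean hvar]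
    exact hlt
  have hint : ∀ x, Integrable (estimate h w x T leastSquares) P := fun x => by
    refine ((hint0 x).add (integrable_const x)).congr (.of_forall fun ω => ?_)
    simp
  refine ⟨hT, hfin, measurable_leastSquares, hint, fun x => ?_⟩
  refine (ae_eq_condExp_of_forall_setIntegral_eq hT.measurableSpace_le (hint x)
    (fun _ _ _ => integrableOn_const) (fun A hA _ => ?_) aestronglyMeasurable_const).symm
  have hAm : MeasurableSet A := hT.measurableSpace_le A hA
  have hdisj : Pairwise (Function.onFun Disjoint fun t : ℕ => A ∩ {ω | T ω = WithTop.some t}) := fun s t hst =>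
    Set.disjoint_left.2 fun ω hs ht => hst (by
      have := hs.2.symm.trans ht.2
      exact WithTop.coe_injective this)
  have hzero : ∀ t : ℕ,
      ∫ ω in A ∩ {ω | T ω = WithTop.some t}, (estimate h w x T leastSquares ω - x) ∂P = 0 := fun t => by
    obtain ⟨B, hB, hBA⟩ := (measurableSet_coeffFiltration_iff hh t _).1
      ((hT.measurableSet_inter_eq_iff A t).1 (hA.inter (hT.measurableSet_eq_of_countable' t)))
    set g := fun p : (Fin t → ℝ) × (Fin t → ℝ) =>
      leastSquares t (p.1, fun i => p.1 i * x + p.2 i) - x with hg_def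
    have hg : Measurable g := (measurable_observation t measurable_leastSquares x).sub_const x
    have hm : Measurable fun ω => (initial h t ω, initial w t ω) :=
      (measurable_initial hh t).prodMk (measurable_initial hw t)
    have hBS : MeasurableSet ((B ∩ S t) ×ˢ (Set.univ : Set (Fin t → ℝ))) :=
      (hB.inter (hS t)).prod MeasurableSet.univ
    have hpre : A ∩ {ω | T ω = WithTop.some t} = (fun ω => (initial h t ω, initial w t ω)) ⁻¹'
        ((B ∩ S t) ×ˢ Set.univ) := by
      have h1 : (fun ω => (initial h t ω, initial w t ω)) ⁻¹' ((B ∩ S t) ×ˢ Set.univ) =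
          initial h t ⁻¹' B ∩ initial h t ⁻¹' S t := by ext ω; simp
      rw [h1, hBA, hST t, Set.inter_assoc, Set.inter_self]
    have hcongr : Set.EqOn (fun ω => estimate h w x T leastSquares ω - x)
        (fun ω => g (initial h t ω, initial w t ω)) (A ∩ {ω | T ω = WithTop.some t}) := fun ω hω => by
      simp only [hg_def]
      rw [estimate_of_eq x leastSquares hω.2]
    have hgi : IntegrableOn g ((B ∩ S t) ×ˢ Set.univ)
        ((P.map (initial h t)).prod (Measure.pi fun _ : Fin t => ν)) := by
      rw [← hlaw t, IntegrableOn, Measure.restrict_map hm hBS, ← hpre,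
        integrable_map_measure hg.aestronglyMeasurable hm.aemeasurable]
      exact (hint0 x).integrableOn.congr_fun hcongr (hAm.inter (hTm t))
    rw [setIntegral_congr_fun (hAm.inter (hTm t)) hcongr, hpre,
      ← setIntegral_map hBS hg.aestronglyMeasurable hm.aemeasurable, hlaw t,
      setIntegral_prod _ hgi]
    refine setIntegral_eq_zero_of_forall_eq_zero fun c hc => ?_
    simp only [hg_def, leastSquares_sub (hpos t c hc.2), Measure.restrict_univ]
    exact integral_sum_mul_eval hν hmean _
  have hsum := hasSum_integral_iUnion (μ := P) (fun t => hAm.inter (hTm t)) hdisj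
    (hint0 x).integrableOn
  simp only [hzero] at hsum
  have h0 := hsum.unique hasSum_zero
  have hA' : (⋃ t : ℕ, A ∩ {ω | T ω = WithTop.some t}) =ᵐ[P] A := by
    filter_upwards [hfin] with ω hω
    obtain ⟨t, ht⟩ := WithTop.ne_top_iff_exists.1 hω
    refine propext ⟨fun hx => ?_, fun hx => ?_⟩
    · obtain ⟨_, h2⟩ := Set.mem_iUnion.1 hx
      exact h2.1
    · exact Set.mem_iUnion.2 ⟨t, hx, ht.symm⟩
  rw [setIntegral_congr_set hA', integral_sub (hint x).integrableOn integrableOn_const,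
    sub_eq_zero] at h0
  exact h0.symm

end Stopped

end SeqEst

namespace SeqEst

/-! ### Pathwise properties of the energy and the threshold time. -/

section Pathwise

variable {Ω : Type*} {h : ℕ → Ω → ℝ}

theorem energy_succ (h : ℕ → Ω → ℝ) (t : ℕ) (ω : Ω) :
    energy h (t + 1) ω = energy h t ω + h t ω ^ 2 :=
  Finset.sum_range_succ _ _

theorem monotone_energy (h : ℕ → Ω → ℝ) (ω : Ω) : Monotone fun t => energy h t ω :=
  monotone_nat_of_le_succ fun t => by
    rw [energy_succ]
    exact le_add_of_nonneg_right (sq_nonneg _)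

/-- The energy is monotone, so having hit the level before `t` is the same as being above it at `t`.
The restriction to times from `1` on is harmless because the energy at time `0` is zero. -/
theorem thresholdTime_le_iff {c : ℝ} (hc : 0 < c) {t : ℕ} {ω : Ω} :
    thresholdTime h c ω ≤ WithTop.some t ↔ 1 / c ≤ energy h t ω := by
  rw [thresholdTime, hittingAfter_le_iff]
  constructor
  · rintro ⟨j, hj, hje⟩
    exact le_trans hje (monotone_energy h ω hj.2)
  · intro hle
    refine ⟨t, ⟨Nat.one_le_iff_ne_zero.2 fun h0 => ?_, le_rfl⟩, hle⟩
    rw [h0, energy, Finset.sum_range_zero] at hle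
    exact absurd hle (not_le.2 (by positivity))

theorem lt_thresholdTime_iff {c : ℝ} (hc : 0 < c) {t : ℕ} {ω : Ω} :
    WithTop.some t < thresholdTime h c ω ↔ energy h t ω < 1 / c := by
  rw [← not_le, thresholdTime_le_iff hc, not_le]

theorem toENNReal_eq_tsum (n : WithTop ℕ) :
    ENat.toENNReal n = ∑' t : ℕ, if WithTop.some t < n then (1 : ℝ≥0∞) else 0 := by
  cases n with
  | top =>
    simp only [WithTop.coe_lt_top, if_true]
    rw [ENNReal.tsum_const_eq_top_of_ne_zero one_ne_zero]
    rfl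
  | coe n =>
    rw [tsum_eq_sum (s := Finset.range n) fun t ht => if_neg fun hlt => ht
      (Finset.mem_range.2 (WithTop.coe_lt_coe.1 hlt))]
    rw [Finset.sum_congr rfl fun t ht => if_pos (WithTop.coe_lt_coe.2 (Finset.mem_range.1 ht))]
    simp only [Finset.sum_const, Finset.card_range, nsmul_eq_mul, mul_one]
    rfl

theorem inv_ofReal_eq_add_tsum {u : ℕ → ℝ} (hu : Monotone u) {n m : ℕ} (hnm : n ≤ m)
    (hn : 0 < u n) :
    (ENNReal.ofReal (u n))⁻¹ = (ENNReal.ofReal (u m))⁻¹ +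
      ∑' t, if n ≤ t ∧ t < m then ENNReal.ofReal (1 / u t - 1 / u (t + 1)) else 0 := by
  have hpos : ∀ t, n ≤ t → 0 < u t := fun t ht => hn.trans_le (hu ht)
  rw [tsum_eq_sum (s := Finset.Ico n m) fun t ht => if_neg fun hlt => ht
      (Finset.mem_Ico.2 hlt),
    Finset.sum_congr rfl fun t ht => if_pos (Finset.mem_Ico.1 ht),
    ← ENNReal.ofReal_sum_of_nonneg fun t ht => sub_nonneg.2
      (one_div_le_one_div_of_le (hpos t (Finset.mem_Ico.1 ht).1) (hu (Nat.le_succ t))),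
    ← ENNReal.ofReal_inv_of_pos hn, ← ENNReal.ofReal_inv_of_pos (hpos m hnm)]
  have htel : ∑ t ∈ Finset.Ico n m, (1 / u t - 1 / u (t + 1)) = 1 / u n - 1 / u m := by
    rw [← neg_inj, ← Finset.sum_neg_distrib, neg_sub]
    simp only [neg_sub]
    exact Finset.sum_Ico_sub (fun t => 1 / u t) hnm
  rw [htel, ← ENNReal.ofReal_add (inv_nonneg.2 (hpos m hnm).le)
    (sub_nonneg.2 (one_div_le_one_div_of_le hn (hu hnm)))]
  congr 1
  simp

/-- Telescoping of `1 / u` between two times in unknown order: one of the two sums is empty. The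
additive form avoids subtraction in `[0, ∞]`. -/
theorem inv_ofReal_add_tsum_comm {u : ℕ → ℝ} (hu : Monotone u) {n m : ℕ} (hn : 0 < u n)
    (hm : 0 < u m) :
    (ENNReal.ofReal (u n))⁻¹ +
        (∑' t, if m ≤ t ∧ t < n then ENNReal.ofReal (1 / u t - 1 / u (t + 1)) else 0) =
      (ENNReal.ofReal (u m))⁻¹ +
        ∑' t, if n ≤ t ∧ t < m then ENNReal.ofReal (1 / u t - 1 / u (t + 1)) else 0 := by
  have key : ∀ n m : ℕ, n ≤ m → (∑' t, if m ≤ t ∧ t < n then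
      ENNReal.ofReal (1 / u t - 1 / u (t + 1)) else 0) = 0 := fun n m hnm =>
    ENNReal.tsum_eq_zero.2 fun t => if_neg fun ht => by lia
  rcases le_total n m with hnm | hmn
  · rw [key n m hnm, add_zero, inv_ofReal_eq_add_tsum hu hnm hn]
  · rw [key m n hmn, add_zero, ← inv_ofReal_eq_add_tsum hu hmn hm]

/-- Before the last active step the truncated sum is below `r`, and truncation at `1` bounds the
overshoot. -/
theorem tsum_min_sq_le (h : ℕ → Ω → ℝ) {r : ℝ} (hr : 0 ≤ r) (ω : Ω) :
    (∑' t, if energy h t ω < r then ENNReal.ofReal (min (h t ω ^ 2) 1) else 0) ≤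
      ENNReal.ofReal (r + 1) := by
  refine ENNReal.tsum_le_of_sum_range_le fun n => ?_
  -- The bound by the energy is carried along because it yields the bound `r + 1` after an active
  -- step.
  have key : ∀ n, ∑ t ∈ Finset.range n, (if energy h t ω < r then min (h t ω ^ 2) 1 else 0) ≤
      energy h n ω ∧ ∑ t ∈ Finset.range n,
        (if energy h t ω < r then min (h t ω ^ 2) 1 else 0) ≤ r + 1 := fun n => by
    induction n with
    | zero => simp only [Finset.range_zero, Finset.sum_empty, energy]; exact ⟨le_rfl, by linarith⟩
    | succ n ih =>
      rw [Finset.sum_range_succ, energy_succ]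
      have h1 := min_le_left (h n ω ^ 2) 1
      have h2 := min_le_right (h n ω ^ 2) 1
      have h3 := sq_nonneg (h n ω)
      split_ifs with hlt
      · constructor <;> linarith [ih.1]
      · constructor <;> linarith [ih.1, ih.2]
  have hcast : ∀ t, (if energy h t ω < r then ENNReal.ofReal (min (h t ω ^ 2) 1) else 0) =
      ENNReal.ofReal (if energy h t ω < r then min (h t ω ^ 2) 1 else 0) := fun t => by
    split_ifs <;> simp
  simp only [hcast]
  rw [← ENNReal.ofReal_sum_of_nonneg]
  · exact ENNReal.ofReal_le_ofReal (key n).2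
  · intro t _
    split_ifs
    · positivity
    · exact le_rfl

theorem one_div_le_stopped_energy {c : ℝ} (hc : 0 < c) {ω : Ω} (hω : thresholdTime h c ω ≠ ⊤) :
    1 / c ≤ energy h ((thresholdTime h c ω).untopD 0) ω := by
  obtain ⟨n, hn⟩ := WithTop.ne_top_iff_exists.1 hω
  rw [← hn, WithTop.untopD_coe]
  exact (thresholdTime_le_iff hc).1 hn.symm.le

theorem div_stopped_energy_nonneg (σ : ℝ) (T : Ω → WithTop ℕ) (ω : Ω) :
    0 ≤ σ ^ 2 / energy h ((T ω).untopD 0) ω :=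
  div_nonneg (sq_nonneg σ) (Finset.sum_nonneg fun _ _ => sq_nonneg _)

theorem div_stopped_energy_le (σ : ℝ) {c : ℝ} (hc : 0 < c) (ω : Ω) :
    σ ^ 2 / energy h ((thresholdTime h c ω).untopD 0) ω ≤ σ ^ 2 * c := by
  -- On `{T = ⊤}` the default time `0` gives zero energy and the real quotient is `0`, so the bound
  -- needs no exceptional set.
  by_cases hω : thresholdTime h c ω = ⊤
  · rw [hω, WithTop.untopD_top, energy, Finset.sum_range_zero, div_zero]
    positivity
  · have h1 := one_div_le_stopped_energy hc hω
    have h2 : 0 < energy h ((thresholdTime h c ω).untopD 0) ω :=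
      lt_of_lt_of_le (by positivity) h1
    rw [div_le_iff₀ h2, mul_assoc]
    refine le_mul_of_one_le_right (sq_nonneg σ) ?_
    rwa [div_le_iff₀ hc, mul_comm] at h1

theorem thresholdTime_eq_one {c : ℝ} (hc : 0 < c) {ω : Ω} (hω : 1 / c ≤ h 0 ω ^ 2) :
    thresholdTime h c ω = WithTop.some 1 := by
  refine le_antisymm ((thresholdTime_le_iff hc).2 (by simpa [energy] using hω)) ?_
  exact le_hittingAfter ω

/-- If the path does not meet the level `1 / c₀` exactly, a small change of level does not change
the crossing time. -/
theorem continuousAt_stopped_energy {c₀ : ℝ} (hc₀ : 0 < c₀) {ω : Ω}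
    (hω : thresholdTime h c₀ ω ≠ ⊤) (hne : ∀ t, energy h t ω ≠ 1 / c₀) (σ : ℝ) :
    ContinuousAt (fun c => σ ^ 2 / energy h ((thresholdTime h c ω).untopD 0) ω) c₀ := by
  obtain ⟨n, hn⟩ := WithTop.ne_top_iff_exists.1 hω
  have htend : Filter.Tendsto (fun c : ℝ => 1 / c) (nhds c₀) (nhds (1 / c₀)) :=
    tendsto_const_nhds.div Filter.tendsto_id hc₀.ne'
  have hup : ∀ᶠ c in nhds c₀, 1 / c < energy h n ω :=
    htend.eventually_lt_const
      (lt_of_le_of_ne ((thresholdTime_le_iff hc₀).1 hn.symm.le) (hne n).symm)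
  have hlow : ∀ᶠ c in nhds c₀, ∀ t ∈ Finset.range n, energy h t ω < 1 / c := by
    rw [Filter.eventually_all_finset]
    intro t ht
    refine htend.eventually_const_lt ((lt_thresholdTime_iff hc₀).1 ?_)
    rw [← hn]
    exact WithTop.coe_lt_coe.2 (Finset.mem_range.1 ht)
  have heq : ∀ᶠ c in nhds c₀, thresholdTime h c ω = WithTop.some n := by
    filter_upwards [hup, hlow, lt_mem_nhds hc₀] with c h1 h2 hc
    refine le_antisymm ((thresholdTime_le_iff hc).2 h1.le) (not_lt.1 fun h3 => ?_)
    obtain ⟨m, hm⟩ := WithTop.ne_top_iff_exists.1 h3.ne_top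
    rw [← hm] at h3
    have h4 := h2 m (Finset.mem_range.2 (WithTop.coe_lt_coe.1 h3))
    exact absurd ((thresholdTime_le_iff hc).1 hm.symm.le) (not_le.2 h4)
  refine (continuousAt_const (y := σ ^ 2 / energy h n ω)).congr ?_
  filter_upwards [heq] with c hc
  rw [hc, WithTop.untopD_coe]

end Pathwise

variable {Ω : Type*} [MeasurableSpace Ω] {P : Measure Ω} {h w : ℕ → Ω → ℝ}

theorem measurable_energy (hh : ∀ i, Measurable (h i)) (t : ℕ) : Measurable (energy h t) :=
  Finset.measurable_fun_sum _ fun i _ => (hh i).pow_const 2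

theorem isStoppingTime_thresholdTime (hh : ∀ i, Measurable (h i)) {c : ℝ} (hc : 0 < c) :
    IsStoppingTime (coeffFiltration h hh) (thresholdTime h c) := fun t => by
  rw [measurableSet_coeffFiltration_iff]
  refine ⟨{v | 1 / c ≤ ∑ i, v i ^ 2}, measurableSet_le measurable_const (by fun_prop), ?_⟩
  ext ω
  rw [Set.mem_preimage, Set.mem_ofPred_eq, Set.mem_ofPred_eq, thresholdTime_le_iff hc,
    energy_eq_sum_initial]

theorem expectedTime_eq_tsum {T : Ω → WithTop ℕ}
    (hT : ∀ t : ℕ, MeasurableSet {ω | WithTop.some t < T ω}) :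
    expectedTime P T = ∑' t : ℕ, P {ω | WithTop.some t < T ω} := by
  have h1 : ∀ ω, ENat.toENNReal (T ω) = ∑' t : ℕ,
      {ω | WithTop.some t < T ω}.indicator (fun _ => (1 : ℝ≥0∞)) ω := fun ω => by
    simp only [toENNReal_eq_tsum, Set.indicator_apply, Set.mem_ofPred_eq]
  unfold expectedTime
  simp only [h1]
  rw [lintegral_tsum fun t => (measurable_const.indicator (hT t)).aemeasurable]
  refine tsum_congr fun t => ?_
  rw [lintegral_indicator (hT t), setLIntegral_one]

/-- The next coefficient is integrated out given the past ones. -/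
theorem setLIntegral_next [IsProbabilityMeasure P] (hh : ∀ i, Measurable (h i))
    (hh_indep : iIndepFun h P) (hh_ident : ∀ i, IdentDistrib (h i) (h 0) P P) {t : ℕ} {s : Set Ω}
    (hs : MeasurableSet[coeffFiltration h hh t] s) {g : (Fin t → ℝ) × ℝ → ℝ≥0∞}
    (hg : Measurable g) :
    ∫⁻ ω in s, g (initial h t ω, h t ω) ∂P =
      ∫⁻ ω in s, ∫⁻ y, g (initial h t ω, y) ∂(P.map (h 0)) ∂P := by
  obtain ⟨D, hD, rfl⟩ := (measurableSet_coeffFiltration_iff hh t s).1 hs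
  have hH := measurable_initial hh t
  have : IsProbabilityMeasure (P.map (initial h t)) :=
    Measure.isProbabilityMeasure_map hH.aemeasurable
  have : IsProbabilityMeasure (P.map (h 0)) :=
    Measure.isProbabilityMeasure_map (hh 0).aemeasurable
  have hind : IndepFun (initial h t) (h t) P := by
    have h1 := hh_indep.indepFun_finset (Finset.range t) {t} (by simp) hh
    have h2 : Measurable fun (f : Finset.range t → ℝ) (i : Fin t) =>
        f ⟨i, Finset.mem_range.2 i.2⟩ := measurable_pi_lambda _ fun i => measurable_pi_apply _
    have h3 : Measurable fun f : ({t} : Finset ℕ) → ℝ => f ⟨t, Finset.mem_singleton_self t⟩ :=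
      measurable_pi_apply _
    exact h1.comp h2 h3
  have hlaw := hind.map_prod_eq_prod_map_map hH.aemeasurable (hh t).aemeasurable
  rw [(hh_ident t).map_eq] at hlaw
  have hm : Measurable fun ω => (initial h t ω, h t ω) := hH.prodMk (hh t)
  have hpre : initial h t ⁻¹' D = (fun ω => (initial h t ω, h t ω)) ⁻¹' (D ×ˢ Set.univ) := by
    ext ω; simp
  rw [← setLIntegral_map hD (f := fun v => ∫⁻ y, g (v, y) ∂(P.map (h 0)))
      hg.lintegral_prod_right' hH, hpre,
    ← setLIntegral_map (hD.prod MeasurableSet.univ) hg hm, hlaw, ← Measure.prod_restrict,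
    Measure.restrict_univ, lintegral_prod _ hg.aemeasurable]

/-! ### Finite mean of the threshold time. -/

section MeanTime

theorem lintegral_ne_zero_of_coeff (hh : ∀ i, Measurable (h i))
    (hh_ne : ¬ (h 0 =ᵐ[P] fun _ => 0)) {g : ℝ → ℝ≥0∞} (hg : Measurable g)
    (hg0 : ∀ y, g y = 0 → y = 0) : ∫⁻ y, g y ∂(P.map (h 0)) ≠ 0 := fun h0 => by
  have hgm : Measurable fun ω => g (h 0 ω) := hg.comp (hh 0)
  rw [lintegral_map hg (hh 0), lintegral_eq_zero_iff hgm] at h0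
  exact hh_ne (h0.mono fun ω hω => hg0 _ hω)

/-- Wald's identity for the truncated increments `min (h², 1)`: `{t < T}` depends on the past, so
`E[T]` times their mean `m > 0` is the expected sum before `T`, at most `1 / c + 1`. Truncation is
needed since `h²` may have infinite mean. -/
theorem expectedTime_thresholdTime_lt_top [IsProbabilityMeasure P] (hh : ∀ i, Measurable (h i))
    (hh_indep : iIndepFun h P) (hh_ident : ∀ i, IdentDistrib (h i) (h 0) P P)
    (hh_ne : ¬ (h 0 =ᵐ[P] fun _ => 0)) {c : ℝ} (hc : 0 < c) :
    expectedTime P (thresholdTime h c) < ∞ := by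
  set m := ∫⁻ y, ENNReal.ofReal (min (y ^ 2) 1) ∂(P.map (h 0)) with hm_def
  have hm0 : m ≠ 0 := lintegral_ne_zero_of_coeff hh hh_ne
    (g := fun y => ENNReal.ofReal (min (y ^ 2) 1)) (by fun_prop) fun y hy => by
      rw [ENNReal.ofReal_eq_zero] at hy
      rcases min_le_iff.1 hy with h1 | h1
      · exact pow_eq_zero_iff (two_ne_zero) |>.1 (le_antisymm h1 (sq_nonneg y))
      · exact absurd h1 (by norm_num)
  have hT := isStoppingTime_thresholdTime hh hc
  have hlt : ∀ t : ℕ, MeasurableSet[coeffFiltration h hh t]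
      {ω | WithTop.some t < thresholdTime h c ω} := hT.measurableSet_gt
  have hlt' : ∀ t : ℕ, MeasurableSet {ω | WithTop.some t < thresholdTime h c ω} := fun t =>
    (coeffFiltration h hh).le t _ (hlt t)
  have hbound : expectedTime P (thresholdTime h c) * m ≤ ENNReal.ofReal (1 / c + 1) := by
    calc expectedTime P (thresholdTime h c) * m
        = ∑' t : ℕ, ∫⁻ ω in {ω | WithTop.some t < thresholdTime h c ω},
            ENNReal.ofReal (min (h t ω ^ 2) 1) ∂P := by
          rw [expectedTime_eq_tsum hlt', ← ENNReal.tsum_mul_right]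
          refine tsum_congr fun t => ?_
          rw [setLIntegral_next hh hh_indep hh_ident (hlt t)
            (g := fun p => ENNReal.ofReal (min (p.2 ^ 2) 1)) (by fun_prop), mul_comm]
          exact (setLIntegral_const _ _).symm
      _ = ∫⁻ ω, ∑' t, (if energy h t ω < 1 / c then ENNReal.ofReal (min (h t ω ^ 2) 1) else 0)
            ∂P := by
          rw [lintegral_tsum]
          · refine tsum_congr fun t => ?_
            rw [← lintegral_indicator (hlt' t)]
            refine lintegral_congr fun ω => ?_
            simp only [Set.indicator_apply, Set.mem_ofPred_eq, lt_thresholdTime_iff hc]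
          · intro t
            exact (Measurable.ite (measurableSet_lt (measurable_energy hh t) measurable_const)
              (((hh t).pow_const 2).min measurable_const).ennreal_ofReal
              measurable_const).aemeasurable
      _ ≤ ∫⁻ _, ENNReal.ofReal (1 / c + 1) ∂P :=
          lintegral_mono fun ω => tsum_min_sq_le h (by positivity) ω
      _ = ENNReal.ofReal (1 / c + 1) := by simp
  by_contra htop
  rw [not_lt, top_le_iff] at htop
  rw [htop, ENNReal.top_mul hm0] at hbound
  exact absurd hbound (not_le.2 ENNReal.ofReal_lt_top)

theorem ae_ne_top_of_expectedTime_lt_top {T : Ω → WithTop ℕ}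
    (hT : ∀ t : ℕ, MeasurableSet {ω | WithTop.some t < T ω}) (hlt : expectedTime P T < ∞) :
    ∀ᵐ ω ∂P, T ω ≠ ⊤ := by
  have hm : Measurable fun ω => ENat.toENNReal (T ω) := by
    have : (fun ω => ENat.toENNReal (T ω)) = fun ω => ∑' t : ℕ,
        {ω | WithTop.some t < T ω}.indicator (fun _ => (1 : ℝ≥0∞)) ω := by
      ext ω
      simp only [toENNReal_eq_tsum, Set.indicator_apply, Set.mem_ofPred_eq]
    rw [this]
    exact Measurable.tsum fun t => measurable_const.indicator (hT t)
  filter_upwards [ae_lt_top hm hlt.ne] with ω hω htop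
  rw [htop] at hω
  exact absurd hω (lt_irrefl _)

end MeanTime

/-! ### Optimality of the threshold rule among stopping times. -/

section Comparison

/-- Diminishing returns: the reduction equals `y² / (z (z + y²))`, decreasing in `z > 0`. -/
theorem one_div_sub_antitone {r s : ℝ} (hr : 0 < r) (hrs : r ≤ s) (y : ℝ) :
    1 / s - 1 / (s + y ^ 2) ≤ 1 / r - 1 / (r + y ^ 2) := by
  have hy := sq_nonneg y
  have hs := hr.trans_le hrs
  have key : ∀ z : ℝ, 0 < z → 1 / z - 1 / (z + y ^ 2) = y ^ 2 / (z * (z + y ^ 2)) := fun z hz => by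
    have : z + y ^ 2 ≠ 0 := by positivity
    field_simp
    ring
  rw [key r hr, key s hs]
  gcongr

/-- Among all stopping times at which the expected inverse energy is no larger, the threshold rule
has the smallest expectation. -/
theorem expectedTime_thresholdTime_le [IsProbabilityMeasure P] {hh : ∀ i, Measurable (h i)}
    (hh_indep : iIndepFun h P) (hh_ident : ∀ i, IdentDistrib (h i) (h 0) P P)
    (hh_ne : ¬ (h 0 =ᵐ[P] fun _ => 0)) {c : ℝ} (hc : 0 < c) {T' : Ω → WithTop ℕ}
    (hT' : IsStoppingTime (coeffFiltration h hh) T') (hfin' : ∀ᵐ ω ∂P, T' ω ≠ ⊤)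
    (hpos' : ∀ᵐ ω ∂P, 0 < energy h ((T' ω).untopD 0) ω)
    (hle : ∫⁻ ω, (ENNReal.ofReal (energy h ((T' ω).untopD 0) ω))⁻¹ ∂P ≤
      ∫⁻ ω, (ENNReal.ofReal (energy h ((thresholdTime h c ω).untopD 0) ω))⁻¹ ∂P)
    (hlt : ∫⁻ ω, (ENNReal.ofReal (energy h ((thresholdTime h c ω).untopD 0) ω))⁻¹ ∂P < ∞) :
    expectedTime P (thresholdTime h c) ≤ expectedTime P T' := by
  set T := thresholdTime h c with hT_def
  have hT : IsStoppingTime (coeffFiltration h hh) T := isStoppingTime_thresholdTime hh hc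
  have hTm : ∀ t : ℕ, MeasurableSet {ω | WithTop.some t < T ω} := fun t =>
    (coeffFiltration h hh).le t _ (hT.measurableSet_gt t)
  have hTm' : ∀ t : ℕ, MeasurableSet {ω | WithTop.some t < T' ω} := fun t =>
    (coeffFiltration h hh).le t _ (hT'.measurableSet_gt t)
  have hfin : ∀ᵐ ω ∂P, T ω ≠ ⊤ := ae_ne_top_of_expectedTime_lt_top hTm
    (expectedTime_thresholdTime_lt_top hh hh_indep hh_ident hh_ne hc)
  -- `A t`: sample `t` (counted from `0`) is taken by the threshold rule only. `B t`, below: it is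
  -- taken by the competitor only. Both events are decided before that sample is seen.
  set A : ℕ → Set Ω := fun t => {ω | T' ω ≤ WithTop.some t ∧ WithTop.some t < T ω} with hA_def
  set B : ℕ → Set Ω := fun t => {ω | T ω ≤ WithTop.some t ∧ WithTop.some t < T' ω} with hB_def
  have hA : ∀ t, MeasurableSet[coeffFiltration h hh t] (A t) := fun t =>
    (hT' t).inter (hT.measurableSet_gt t)
  have hB : ∀ t, MeasurableSet[coeffFiltration h hh t] (B t) := fun t =>
    (hT t).inter (hT'.measurableSet_gt t)
  have hAm : ∀ t, MeasurableSet (A t) := fun t => (coeffFiltration h hh).le t _ (hA t)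
  have hBm : ∀ t, MeasurableSet (B t) := fun t => (coeffFiltration h hh).le t _ (hB t)
  set Δ : ℕ → Ω → ℝ≥0∞ := fun t ω =>
    ENNReal.ofReal (1 / energy h t ω - 1 / energy h (t + 1) ω) with hΔ_def
  have hΔm : ∀ t, Measurable (Δ t) := fun t =>
    ((measurable_const.div (measurable_energy hh t)).sub
      (measurable_const.div (measurable_energy hh (t + 1)))).ennreal_ofReal
  set ψ : ℝ → ℝ≥0∞ := fun r =>
    ∫⁻ y, ENNReal.ofReal (1 / r - 1 / (r + y ^ 2)) ∂(P.map (h 0)) with hψ_def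
  have hψ_anti : ∀ r s, 0 < r → r ≤ s → ψ s ≤ ψ r := fun r s hr hrs =>
    lintegral_mono fun y => ENNReal.ofReal_le_ofReal (one_div_sub_antitone hr hrs y)
  have hstep : ∀ t (s : Set Ω), MeasurableSet[coeffFiltration h hh t] s →
      ∫⁻ ω in s, Δ t ω ∂P = ∫⁻ ω in s, ψ (energy h t ω) ∂P := fun t s hs => by
    have := setLIntegral_next hh hh_indep hh_ident hs
      (g := fun p => ENNReal.ofReal (1 / (∑ i, p.1 i ^ 2) - 1 / (∑ i, p.1 i ^ 2 + p.2 ^ 2)))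
      (by fun_prop)
    simpa only [← energy_eq_sum_initial, ← energy_succ] using this
  have hc' : 0 < 1 / c := by positivity
  have hψ0 : ψ (1 / c) ≠ 0 := lintegral_ne_zero_of_coeff hh hh_ne
    (g := fun y => ENNReal.ofReal (1 / (1 / c) - 1 / (1 / c + y ^ 2))) (by fun_prop) fun y hy => by
      by_contra hy0
      rw [ENNReal.ofReal_eq_zero, sub_nonpos] at hy
      refine absurd hy (not_le.2 (one_div_lt_one_div_of_lt hc' ?_))
      have : 0 < y ^ 2 := by positivity
      linarith
  have hψtop : ψ (1 / c) ≠ ∞ := by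
    have : IsProbabilityMeasure (P.map (h 0)) :=
      Measure.isProbabilityMeasure_map (hh 0).aemeasurable
    refine ne_top_of_le_ne_top (b := ENNReal.ofReal (1 / (1 / c))) ENNReal.ofReal_ne_top ?_
    calc ψ (1 / c) ≤ ∫⁻ _, ENNReal.ofReal (1 / (1 / c)) ∂(P.map (h 0)) :=
          lintegral_mono fun y => ENNReal.ofReal_le_ofReal (sub_le_self _ (by positivity))
      _ = _ := by simp
  -- The threshold rule is still running, so the energy is below `1 / c`. Positivity of the energy
  -- at `T'` matters: `ψ` is monotone on positive levels only, as `1 / 0 = 0`.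
  have hAle : ∀ t, ψ (1 / c) * P (A t) ≤ ∫⁻ ω in A t, Δ t ω ∂P := fun t => by
    rw [hstep t _ (hA t), ← setLIntegral_const]
    refine lintegral_mono_ae ((ae_restrict_iff' (hAm t)).2 ?_)
    filter_upwards [hpos', hfin'] with ω hω hωt hωA
    obtain ⟨n, hn⟩ := WithTop.ne_top_iff_exists.1 hωt
    rw [← hn, WithTop.untopD_coe] at hω
    have hnt : n ≤ t := WithTop.coe_le_coe.1 (hn ▸ hωA.1)
    exact hψ_anti _ _ (hω.trans_le (monotone_energy h ω hnt))
      ((lt_thresholdTime_iff hc).1 hωA.2).le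
  have hBle : ∀ t, ∫⁻ ω in B t, Δ t ω ∂P ≤ ψ (1 / c) * P (B t) := fun t => by
    rw [hstep t _ (hB t), ← setLIntegral_const]
    refine setLIntegral_mono measurable_const fun ω hω => ?_
    exact hψ_anti _ _ hc' ((thresholdTime_le_iff hc).1 hω.1)
  have hG : ∫⁻ ω, (ENNReal.ofReal (energy h ((T ω).untopD 0) ω))⁻¹ ∂P +
        ∑' t, ∫⁻ ω in A t, Δ t ω ∂P =
      ∫⁻ ω, (ENNReal.ofReal (energy h ((T' ω).untopD 0) ω))⁻¹ ∂P +
        ∑' t, ∫⁻ ω in B t, Δ t ω ∂P := by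
    have hsum : ∀ D : ℕ → Set Ω, (∀ t, MeasurableSet (D t)) →
        ∑' t, ∫⁻ ω in D t, Δ t ω ∂P = ∫⁻ ω, ∑' t, (D t).indicator (Δ t) ω ∂P := fun D hD => by
      rw [lintegral_tsum fun t => ((hΔm t).indicator (hD t)).aemeasurable]
      exact tsum_congr fun t => (lintegral_indicator (hD t) _).symm
    have hsm : ∀ D : ℕ → Set Ω, (∀ t, MeasurableSet (D t)) →
        Measurable fun ω => ∑' t, (D t).indicator (Δ t) ω := fun D hD =>
      Measurable.tsum fun t => (hΔm t).indicator (hD t)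
    rw [hsum A hAm, hsum B hBm, ← lintegral_add_right _ (hsm A hAm),
      ← lintegral_add_right _ (hsm B hBm)]
    refine lintegral_congr_ae ?_
    filter_upwards [hfin, hfin', hpos'] with ω hω hω' hωp
    obtain ⟨n, hn⟩ := WithTop.ne_top_iff_exists.1 hω
    obtain ⟨m, hm⟩ := WithTop.ne_top_iff_exists.1 hω'
    have hn_pos : 0 < energy h n ω := hc'.trans_le ((thresholdTime_le_iff hc).1 hn.symm.le)
    rw [← hm, WithTop.untopD_coe] at hωp
    have := inv_ofReal_add_tsum_comm (monotone_energy h ω) hn_pos hωp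
    simp only [← hn, ← hm, WithTop.untopD_coe, hA_def, hB_def, Set.indicator_apply,
      Set.mem_ofPred_eq, WithTop.coe_le_coe, WithTop.coe_lt_coe]
    exact this
  have hΔle : ∑' t, ∫⁻ ω in A t, Δ t ω ∂P ≤ ∑' t, ∫⁻ ω in B t, Δ t ω ∂P := by
    have h1 : ∫⁻ ω, (ENNReal.ofReal (energy h ((T ω).untopD 0) ω))⁻¹ ∂P +
          ∑' t, ∫⁻ ω in A t, Δ t ω ∂P ≤
        ∫⁻ ω, (ENNReal.ofReal (energy h ((T ω).untopD 0) ω))⁻¹ ∂P +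
          ∑' t, ∫⁻ ω in B t, Δ t ω ∂P := hG.trans_le (by gcongr)
    exact (ENNReal.add_le_add_iff_left hlt.ne).1 h1
  have hAB : ∑' t, P (A t) ≤ ∑' t, P (B t) := by
    have h1 : ψ (1 / c) * ∑' t, P (A t) ≤ ψ (1 / c) * ∑' t, P (B t) := by
      rw [← ENNReal.tsum_mul_left, ← ENNReal.tsum_mul_left]
      exact ((ENNReal.tsum_le_tsum hAle).trans hΔle).trans (ENNReal.tsum_le_tsum hBle)
    exact (ENNReal.mul_le_mul_iff_right hψ0 hψtop).1 h1
  rw [expectedTime_eq_tsum hTm, expectedTime_eq_tsum hTm']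
  by_cases htop : ∑' t : ℕ, P {ω | WithTop.some t < T' ω} = ∞
  · rw [htop]; exact le_top
  have hBtop : ∑' t, P (B t) ≠ ∞ := ne_top_of_le_ne_top htop
    (ENNReal.tsum_le_tsum fun t => measure_mono fun ω hω => hω.2)
  -- Both sides measure the event that at least one of the two rules is still running at `t`.
  have hcount : ∀ t : ℕ, P {ω | WithTop.some t < T ω} + P (B t) =
      P {ω | WithTop.some t < T' ω} + P (A t) := fun t => by
    rw [← measure_union _ (hBm t), ← measure_union _ (hAm t)]
    · congr 1
      ext ω
      simp only [hA_def, hB_def, Set.mem_union, Set.mem_ofPred_eq]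
      rw [← not_lt, ← not_lt]
      tauto
    · exact Set.disjoint_left.2 fun ω h1 h2 => absurd h1 (not_lt.2 h2.1)
    · exact Set.disjoint_left.2 fun ω h1 h2 => absurd h1 (not_lt.2 h2.1)
  have hfinal : ∑' t : ℕ, P {ω | WithTop.some t < T ω} + ∑' t, P (B t) ≤
      ∑' t : ℕ, P {ω | WithTop.some t < T' ω} + ∑' t, P (B t) := by
    calc _ = ∑' t : ℕ, P {ω | WithTop.some t < T' ω} + ∑' t, P (A t) := by
          rw [← ENNReal.tsum_add, ← ENNReal.tsum_add]
          exact tsum_congr hcount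
      _ ≤ _ := by gcongr
  exact (ENNReal.add_le_add_iff_right hBtop).1 hfinal

end Comparison

end SeqEst

/-! ### Expectation of the stopped inverse energy. -/

namespace SeqEst

variable {Ω : Type*} [MeasurableSpace Ω] {P : Measure Ω} {h w : ℕ → Ω → ℝ}

theorem measurable_stopped_energy {hh : ∀ i, Measurable (h i)} {T : Ω → WithTop ℕ}
    (hT : IsStoppingTime (coeffFiltration h hh) T) :
    Measurable fun ω => energy h ((T ω).untopD 0) ω := by
  have hTm : ∀ t : ℕ, MeasurableSet {ω | T ω = WithTop.some t} := fun t =>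
    (coeffFiltration h hh).le t _ (hT.measurableSet_eq_of_countable t)
  have : Measurable fun p : ℕ × Ω => energy h p.1 p.2 :=
    measurable_from_prod_countable_right (measurable_energy hh)
  exact this.comp ((measurable_untopD hTm).prodMk measurable_id)

theorem integrable_div_stopped_energy [IsFiniteMeasure P] (hh : ∀ i, Measurable (h i)) (σ : ℝ)
    {c : ℝ} (hc : 0 < c) :
    Integrable (fun ω => σ ^ 2 / energy h ((thresholdTime h c ω).untopD 0) ω) P := by
  refine Integrable.of_bound (measurable_const.div (measurable_stopped_energy
    (isStoppingTime_thresholdTime hh hc))).aestronglyMeasurable (σ ^ 2 * c) (.of_forall fun ω => ?_)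
  rw [Real.norm_of_nonneg (div_stopped_energy_nonneg σ _ ω)]
  exact div_stopped_energy_le σ hc ω

theorem ae_thresholdTime_ne_top [IsProbabilityMeasure P] (hh : ∀ i, Measurable (h i))
    (hh_indep : iIndepFun h P) (hh_ident : ∀ i, IdentDistrib (h i) (h 0) P P)
    (hh_ne : ¬ (h 0 =ᵐ[P] fun _ => 0)) {c : ℝ} (hc : 0 < c) :
    ∀ᵐ ω ∂P, thresholdTime h c ω ≠ ⊤ :=
  ae_ne_top_of_expectedTime_lt_top
    (fun t => (coeffFiltration h hh).le t _
      ((isStoppingTime_thresholdTime hh hc).measurableSet_gt t))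
    (expectedTime_thresholdTime_lt_top hh hh_indep hh_ident hh_ne hc)

/-- Division by zero energy gives `0` in `ℝ` but `∞` in `[0, ∞]` when `σ ≠ 0`; the conventions
differ only on the null event `{T = ⊤}`. -/
theorem lintegral_div_stopped_energy [IsProbabilityMeasure P] (hh : ∀ i, Measurable (h i))
    (hh_indep : iIndepFun h P) (hh_ident : ∀ i, IdentDistrib (h i) (h 0) P P)
    (hh_ne : ¬ (h 0 =ᵐ[P] fun _ => 0)) (σ : ℝ) {c : ℝ} (hc : 0 < c) :
    ∫⁻ ω, ENNReal.ofReal (σ ^ 2) /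
        ENNReal.ofReal (energy h ((thresholdTime h c ω).untopD 0) ω) ∂P =
      ENNReal.ofReal (∫ ω, σ ^ 2 / energy h ((thresholdTime h c ω).untopD 0) ω ∂P) := by
  rw [ofReal_integral_eq_lintegral_ofReal (integrable_div_stopped_energy hh σ hc)
    (.of_forall fun ω => div_stopped_energy_nonneg σ _ ω)]
  refine lintegral_congr_ae ?_
  filter_upwards [ae_thresholdTime_ne_top hh hh_indep hh_ident hh_ne hc] with ω hω
  rw [ENNReal.ofReal_div_of_pos
    (lt_of_lt_of_le (by positivity) (one_div_le_stopped_energy hc hω))]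

/-! ### Existence of a threshold for atomless coefficients. -/

section Existence

/-- Given the earlier coefficients, the last one would have to be one of two points `±√(r - ∑ …)`.
At time `0` the energy is zero, hence the assumption `0 < r`. -/
theorem measure_energy_eq_zero [IsProbabilityMeasure P] (hh : ∀ i, Measurable (h i))
    (hh_indep : iIndepFun h P) (hh_ident : ∀ i, IdentDistrib (h i) (h 0) P P)
    (hatom : ∀ a : ℝ, P {ω | h 0 ω = a} = 0) {r : ℝ} (hr : 0 < r) (t : ℕ) :
    P {ω | energy h t ω = r} = 0 := by
  cases t with
  | zero =>
    convert measure_empty (μ := P)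
    ext ω
    simpa [energy] using hr.ne
  | succ t =>
    have hsingle : ∀ a, (P.map (h 0)) {a} = 0 := fun a => by
      rw [Measure.map_apply (hh 0) (measurableSet_singleton a)]
      exact hatom a
    have hD : MeasurableSet {p : (Fin t → ℝ) × ℝ | ∑ i, p.1 i ^ 2 + p.2 ^ 2 = r} :=
      measurableSet_eq_fun (by fun_prop) measurable_const
    have key := setLIntegral_next hh hh_indep hh_ident
      (MeasurableSet.univ (α := Ω) (m := coeffFiltration h hh t))
      (g := Set.indicator {p : (Fin t → ℝ) × ℝ | ∑ i, p.1 i ^ 2 + p.2 ^ 2 = r} fun _ => 1)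
      (measurable_const.indicator hD)
    have hleft : ∫⁻ ω in Set.univ, Set.indicator
        {p : (Fin t → ℝ) × ℝ | ∑ i, p.1 i ^ 2 + p.2 ^ 2 = r} (fun _ => (1 : ℝ≥0∞))
          (initial h t ω, h t ω) ∂P = P {ω | energy h (t + 1) ω = r} := by
      rw [setLIntegral_univ, ← lintegral_indicator_one
        (measurableSet_eq_fun (measurable_energy hh (t + 1)) measurable_const)]
      refine lintegral_congr fun ω => ?_
      simp only [Set.indicator_apply, Set.mem_ofPred_eq, ← energy_eq_sum_initial, ← energy_succ,
        Pi.one_apply]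
    rw [← hleft, key, setLIntegral_univ, lintegral_eq_zero_of_ae_eq_zero]
    refine .of_forall fun ω => le_antisymm ?_ zero_le
    have hE : MeasurableSet {y : ℝ | ∑ i, initial h t ω i ^ 2 + y ^ 2 = r} :=
      measurableSet_eq_fun (by fun_prop) measurable_const
    calc ∫⁻ y, Set.indicator {p : (Fin t → ℝ) × ℝ | ∑ i, p.1 i ^ 2 + p.2 ^ 2 = r}
          (fun _ => (1 : ℝ≥0∞)) (initial h t ω, y) ∂(P.map (h 0))
        = (P.map (h 0)) {y : ℝ | ∑ i, initial h t ω i ^ 2 + y ^ 2 = r} := by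
          rw [← lintegral_indicator_one hE]
          rfl
      _ ≤ (P.map (h 0)) ({√(r - ∑ i, initial h t ω i ^ 2)} ∪
            {-√(r - ∑ i, initial h t ω i ^ 2)}) := by
          refine measure_mono fun y hy => ?_
          have h1 : r - ∑ i, initial h t ω i ^ 2 = y ^ 2 := by
            have h2 : ∑ i, initial h t ω i ^ 2 + y ^ 2 = r := hy
            rw [← h2]; ring
          rw [h1, Real.sqrt_sq_eq_abs]
          rcases abs_choice y with h2 | h2
          · left; rw [h2]; rfl
          · right; rw [h2, neg_neg]; rfl
      _ ≤ 0 := (measure_union_le _ _).trans (by rw [hsingle, hsingle, add_zero])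

theorem continuousAt_integral_div_stopped_energy [IsProbabilityMeasure P]
    (hh : ∀ i, Measurable (h i)) (hh_indep : iIndepFun h P)
    (hh_ident : ∀ i, IdentDistrib (h i) (h 0) P P) (hh_ne : ¬ (h 0 =ᵐ[P] fun _ => 0))
    (hatom : ∀ a : ℝ, P {ω | h 0 ω = a} = 0) (σ : ℝ) {c₀ : ℝ} (hc₀ : 0 < c₀) :
    ContinuousAt
      (fun c => ∫ ω, σ ^ 2 / energy h ((thresholdTime h c ω).untopD 0) ω ∂P) c₀ := by
  refine continuousAt_of_dominated (bound := fun _ => σ ^ 2 * (2 * c₀)) ?_ ?_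
    (integrable_const _) ?_
  · filter_upwards [lt_mem_nhds hc₀] with c hc
    exact (integrable_div_stopped_energy hh σ hc).aestronglyMeasurable
  · filter_upwards [lt_mem_nhds hc₀, gt_mem_nhds (show c₀ < 2 * c₀ by linarith)] with c hc hc2
    refine .of_forall fun ω => ?_
    rw [Real.norm_of_nonneg (div_stopped_energy_nonneg σ _ ω)]
    exact (div_stopped_energy_le σ hc ω).trans (by gcongr)
  · have hne : ∀ᵐ ω ∂P, ∀ t, energy h t ω ≠ 1 / c₀ := ae_all_iff.2 fun t => by
      rw [ae_iff]
      simpa only [not_not] using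
        measure_energy_eq_zero hh hh_indep hh_ident hatom (r := 1 / c₀) (by positivity) t
    filter_upwards [hne, ae_thresholdTime_ne_top hh hh_indep hh_ident hh_ne hc₀] with ω h1 h2
    exact continuousAt_stopped_energy hc₀ h2 h1 σ

/-- Along `c = n + 1` the rule eventually stops after one sample on almost every path, since `h 0 ≠
0` almost surely. If all values stayed below `C`, Fatou would bound `E[σ² / h²]` by `C`; this also
covers an infinite expectation. -/
theorem exists_le_integral_div_stopped_energy [IsProbabilityMeasure P]
    (hh : ∀ i, Measurable (h i)) (hh_indep : iIndepFun h P)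
    (hh_ident : ∀ i, IdentDistrib (h i) (h 0) P P) (hh_ne : ¬ (h 0 =ᵐ[P] fun _ => 0))
    (hatom : ∀ a : ℝ, P {ω | h 0 ω = a} = 0) {σ C : ℝ}
    (hCσ : ENNReal.ofReal C <
      ∫⁻ ω, ENNReal.ofReal (σ ^ 2) / ENNReal.ofReal (h 0 ω ^ 2) ∂P) :
    ∃ c : ℝ, 0 < c ∧
      C ≤ ∫ ω, σ ^ 2 / energy h ((thresholdTime h c ω).untopD 0) ω ∂P := by
  by_contra! hcon
  refine absurd hCσ (not_lt.2 ?_)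
  set F : ℕ → Ω → ℝ≥0∞ := fun n ω => ENNReal.ofReal (σ ^ 2) /
    ENNReal.ofReal (energy h ((thresholdTime h (n + 1 : ℝ) ω).untopD 0) ω) with hF_def
  have hFm : ∀ n, Measurable (F n) := fun n => measurable_const.div
    (measurable_stopped_energy (isStoppingTime_thresholdTime hh (by positivity))).ennreal_ofReal
  have hFle : ∀ n, ∫⁻ ω, F n ω ∂P ≤ ENNReal.ofReal C := fun n => by
    rw [lintegral_div_stopped_energy hh hh_indep hh_ident hh_ne σ (by positivity)]
    exact ENNReal.ofReal_le_ofReal (hcon _ (by positivity)).le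
  calc ∫⁻ ω, ENNReal.ofReal (σ ^ 2) / ENNReal.ofReal (h 0 ω ^ 2) ∂P
      = ∫⁻ ω, Filter.liminf (fun n => F n ω) Filter.atTop ∂P := by
        refine lintegral_congr_ae ?_
        have h0 : ∀ᵐ ω ∂P, h 0 ω ≠ 0 := by
          rw [ae_iff]; simpa only [not_not] using hatom 0
        filter_upwards [h0] with ω hω
        have hlim : Filter.Tendsto (fun n => F n ω) Filter.atTop
            (nhds (ENNReal.ofReal (σ ^ 2) / ENNReal.ofReal (h 0 ω ^ 2))) := by
          refine tendsto_const_nhds.congr' ?_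
          have h1 : ∀ᶠ n : ℕ in Filter.atTop, (1 : ℝ) / (n + 1) < h 0 ω ^ 2 :=
            tendsto_one_div_add_atTop_nhds_zero_nat.eventually_lt_const (by positivity)
          filter_upwards [h1] with n hn
          simp only [hF_def]
          rw [thresholdTime_eq_one (by positivity) hn.le, WithTop.untopD_coe, energy,
            Finset.sum_range_one]
        exact hlim.liminf_eq.symm
    _ ≤ Filter.liminf (fun n => ∫⁻ ω, F n ω ∂P) Filter.atTop := lintegral_liminf_le hFm
    _ ≤ ENNReal.ofReal C :=
        (Filter.liminf_le_liminf (.of_forall hFle)).trans_eq (Filter.liminf_const _)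

theorem exists_threshold [IsProbabilityMeasure P]
    (hh : ∀ i, Measurable (h i)) (hh_indep : iIndepFun h P)
    (hh_ident : ∀ i, IdentDistrib (h i) (h 0) P P) (hh_ne : ¬ (h 0 =ᵐ[P] fun _ => 0))
    (hatom : ∀ a : ℝ, P {ω | h 0 ω = a} = 0) {σ C : ℝ} (hσ : 0 < σ) (hC : 0 < C)
    (hCσ : ENNReal.ofReal C <
      ∫⁻ ω, ENNReal.ofReal (σ ^ 2) / ENNReal.ofReal (h 0 ω ^ 2) ∂P) :
    ∃ c : ℝ, 0 < c ∧
      ∫ ω, σ ^ 2 / energy h ((thresholdTime h c ω).untopD 0) ω ∂P = C := by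
  obtain ⟨c₂, hc₂, hle₂⟩ :=
    exists_le_integral_div_stopped_energy hh hh_indep hh_ident hh_ne hatom hCσ
  -- Lower endpoint: the stopped quotient is at most `σ² c`, which equals `C` here. Its order
  -- relative to `c₂` is left open, hence `Set.uIcc`.
  have hc₁ : 0 < C / σ ^ 2 := by positivity
  have hle₁ : ∫ ω, σ ^ 2 / energy h ((thresholdTime h (C / σ ^ 2) ω).untopD 0) ω ∂P ≤ C := by
    calc _ ≤ ∫ _, σ ^ 2 * (C / σ ^ 2) ∂P :=
          integral_mono (integrable_div_stopped_energy hh σ hc₁) (integrable_const _)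
            fun ω => div_stopped_energy_le σ hc₁ ω
      _ = C := by
          rw [integral_const, probReal_univ, one_smul]
          field_simp
  have hpos : ∀ c ∈ Set.uIcc (C / σ ^ 2) c₂, 0 < c := fun c hcm =>
    (lt_min hc₁ hc₂).trans_le hcm.1
  have hcont : ContinuousOn
      (fun c => ∫ ω, σ ^ 2 / energy h ((thresholdTime h c ω).untopD 0) ω ∂P)
      (Set.uIcc (C / σ ^ 2) c₂) := fun c hcm =>
    (continuousAt_integral_div_stopped_energy hh hh_indep hh_ident hh_ne hatom σ
      (hpos c hcm)).continuousWithinAt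
  obtain ⟨c, hcm, hcC⟩ := intermediate_value_uIcc hcont (Set.mem_uIcc_of_le hle₁ hle₂)
  exact ⟨c, hpos c hcm, hcC⟩

end Existence

/-! ### Reduction of the estimation problem to the stopping problem. -/

section Optimality

/-- Zero energy makes the quotient infinite, so a competitor of finite variance almost surely does
not stop before collecting energy; this also rules out `T = 0`. -/
theorem ae_stopped_energy_pos {hh : ∀ i, Measurable (h i)} {T : Ω → WithTop ℕ} {σ : ℝ}
    (hσ : 0 < σ) (hT : IsStoppingTime (coeffFiltration h hh) T)
    (hlt : ∫⁻ ω, ENNReal.ofReal (σ ^ 2) / ENNReal.ofReal (energy h ((T ω).untopD 0) ω) ∂P < ∞) :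
    ∀ᵐ ω ∂P, 0 < energy h ((T ω).untopD 0) ω := by
  have hm : Measurable fun ω =>
      ENNReal.ofReal (σ ^ 2) / ENNReal.ofReal (energy h ((T ω).untopD 0) ω) :=
    measurable_const.div (measurable_stopped_energy hT).ennreal_ofReal
  filter_upwards [ae_lt_top hm hlt.ne] with ω hω
  by_contra hle
  have hne : ENNReal.ofReal (σ ^ 2) ≠ 0 := (ENNReal.ofReal_pos.2 (by positivity)).ne'
  rw [ENNReal.ofReal_of_nonpos (not_lt.1 hle), ENNReal.div_zero hne] at hω
  exact lt_irrefl _ hω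

/-- The threshold rule with the least squares estimator is optimal in every class of estimators
in which the variance is bounded below by the expected inverse energy. -/
theorem isOptimalPair_thresholdTime [IsProbabilityMeasure P] {hh : ∀ i, Measurable (h i)}
    (hh_indep : iIndepFun h P) (hh_ident : ∀ i, IdentDistrib (h i) (h 0) P P)
    (hh_ne : ¬ (h 0 =ᵐ[P] fun _ => 0)) {x σ C c : ℝ} (hσ : 0 < σ) (hc : 0 < c)
    (hcC : ∫ ω, σ ^ 2 / energy h ((thresholdTime h c ω).untopD 0) ω ∂P = C)
    {K : Set Estimator} (hK : leastSquares ∈ K)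
    (hbound : ∀ T φ, φ ∈ K → IsAdmissible P h w hh T φ →
      ∫⁻ ω, ENNReal.ofReal (σ ^ 2) / ENNReal.ofReal (energy h ((T ω).untopD 0) ω) ∂P ≤
        evariance (estimate h w x T φ) P)
    (hadm : IsAdmissible P h w hh (thresholdTime h c) leastSquares)
    (hvar : evariance (estimate h w x (thresholdTime h c) leastSquares) P = ENNReal.ofReal C) :
    IsOptimalPair P h w hh K x C (thresholdTime h c) leastSquares ∧
      IsOptimalEstimatorAt P h w hh K x (thresholdTime h c) leastSquares := by
  have hG : ∫⁻ ω, ENNReal.ofReal (σ ^ 2) /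
      ENNReal.ofReal (energy h ((thresholdTime h c ω).untopD 0) ω) ∂P = ENNReal.ofReal C := by
    rw [lintegral_div_stopped_energy hh hh_indep hh_ident hh_ne σ hc, hcC]
  have hσ0 : ENNReal.ofReal (σ ^ 2) ≠ 0 := (ENNReal.ofReal_pos.2 (by positivity)).ne'
  have hdiv : ∀ T : Ω → WithTop ℕ,
      ∫⁻ ω, ENNReal.ofReal (σ ^ 2) / ENNReal.ofReal (energy h ((T ω).untopD 0) ω) ∂P =
        ENNReal.ofReal (σ ^ 2) * ∫⁻ ω, (ENNReal.ofReal (energy h ((T ω).untopD 0) ω))⁻¹ ∂P :=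
    fun T => lintegral_const_mul' _ _ ENNReal.ofReal_ne_top
  refine ⟨⟨⟨hK, hadm, hvar.le⟩, fun T' φ' hfeas => ?_⟩, ⟨hK, hadm⟩, fun φ' hφ' hadm' => ?_⟩
  · obtain ⟨hφ', hadm', hle⟩ := hfeas
    have h1 := (hbound T' φ' hφ' hadm').trans hle
    have hpos := ae_stopped_energy_pos hσ hadm'.stopping (h1.trans_lt ENNReal.ofReal_lt_top)
    rw [← hG, hdiv, hdiv, ENNReal.mul_le_mul_iff_right hσ0 ENNReal.ofReal_ne_top] at h1
    refine expectedTime_thresholdTime_le hh_indep hh_ident hh_ne hc hadm'.stopping hadm'.finite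
      hpos h1 ?_
    refine lt_top_iff_ne_top.2 fun htop => ?_
    rw [hdiv, htop, ENNReal.mul_top hσ0] at hG
    exact ENNReal.ofReal_ne_top hG.symm
  · rw [hvar, ← hG]
    exact hbound _ φ' hφ' hadm'

/-- The least squares estimator at the threshold time is admissible, and its variance is the
expected inverse energy. -/
theorem leastSquares_thresholdTime [IsProbabilityMeasure P] {hh : ∀ i, Measurable (h i)}
    (hh_indep : iIndepFun h P) (hh_ident : ∀ i, IdentDistrib (h i) (h 0) P P)
    (hh_ne : ¬ (h 0 =ᵐ[P] fun _ => 0)) (hw : ∀ i, Measurable (w i)) {ν : Measure ℝ}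
    [IsProbabilityMeasure ν]
    (hlaw : ∀ t, P.map (fun ω => (initial h t ω, initial w t ω)) =
      (P.map (initial h t)).prod (Measure.pi fun _ : Fin t => ν))
    {σ c : ℝ} (hν : MemLp id 2 ν) (hmean : ∫ y, y ∂ν = 0) (hvar : variance id ν = σ ^ 2)
    (hc : 0 < c) :
    IsAdmissible P h w hh (thresholdTime h c) leastSquares ∧
      ∀ x, evariance (estimate h w x (thresholdTime h c) leastSquares) P =
        ENNReal.ofReal (∫ ω, σ ^ 2 / energy h ((thresholdTime h c ω).untopD 0) ω ∂P) := by
  have hT := isStoppingTime_thresholdTime hh hc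
  obtain ⟨S, hS, hST⟩ := exists_preimage_eq_stopping hT
  -- `S t` is determined only on the range of `initial h t` and might contain the zero vector.
  -- Intersecting with positive energy leaves the preimage unchanged.
  have hS' : ∀ t, MeasurableSet (S t ∩ {v | 0 < ∑ i, v i ^ 2}) := fun t =>
    (hS t).inter (measurableSet_lt measurable_const (by fun_prop))
  have hST' : ∀ t : ℕ, initial h t ⁻¹' (S t ∩ {v | 0 < ∑ i, v i ^ 2}) =
      {ω | thresholdTime h c ω = WithTop.some t} := fun t => by
    rw [Set.preimage_inter, hST t]
    refine Set.inter_eq_left.2 fun ω hω => ?_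
    have h1 : 1 / c ≤ energy h t ω := (thresholdTime_le_iff hc).1 (le_of_eq hω)
    rw [energy_eq_sum_initial] at h1
    exact lt_of_lt_of_le (by positivity) h1
  have hfin := ae_thresholdTime_ne_top hh hh_indep hh_ident hh_ne hc
  have hG := lintegral_div_stopped_energy hh hh_indep hh_ident hh_ne σ hc
  have hadm : IsAdmissible P h w hh (thresholdTime h c) leastSquares :=
    isAdmissible_leastSquares hw hlaw hT hS' hST' hfin (fun t v hv => hv.2) hν hmean hvar
      (by rw [hG]; exact ENNReal.ofReal_lt_top)
  refine ⟨hadm, fun x => ?_⟩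
  rw [evariance_eq_lintegral_ofReal, hadm.integral_estimate x,
    lintegral_leastSquares_sub_sq hh hw hlaw hS' hST' hfin (fun t v hv => hv.2) hν hmean hvar, hG]

end Optimality

end SeqEst

theorem theorem1 {Ω : Type*} [MeasurableSpace Ω] (P : Measure Ω) [IsProbabilityMeasure P]
    (h w : ℕ → Ω → ℝ) (x σ C : ℝ) (hσ : 0 < σ) (hC : 0 < C)
    -- the coefficients are i.i.d. and not identically zero
    (hh : ∀ i, Measurable (h i)) (hh_indep : iIndepFun h P)
    (hh_ident : ∀ i, IdentDistrib (h i) (h 0) P P) (hh_ne : ¬ (h 0 =ᵐ[P] fun _ => 0))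
    -- the noise is i.i.d. with mean zero and variance `σ ^ 2`
    (hw : ∀ i, Measurable (w i)) (hw_indep : iIndepFun w P)
    (hw_ident : ∀ i, IdentDistrib (w i) (w 0) P P) (hw_L2 : MemLp (w 0) 2 P)
    (hw_mean : ∫ ω, w 0 ω ∂P = 0) (hw_var : variance (w 0) P = σ ^ 2)
    -- the coefficients and the noise are independent
    (hhw : IndepFun (fun ω i => h i ω) (fun ω i => w i ω) P) :
    (∀ c : ℝ, 0 < c →
      ∫ ω, σ ^ 2 / SeqEst.energy h ((SeqEst.thresholdTime h c ω).untopD 0) ω ∂P = C →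
        SeqEst.expectedTime P (SeqEst.thresholdTime h c) < ∞ ∧
        evariance (SeqEst.estimate h w x (SeqEst.thresholdTime h c) SeqEst.leastSquares) P
          = ENNReal.ofReal C ∧
        -- any noise: optimality among the linear unbiased estimators
        SeqEst.IsOptimalPair P h w hh {φ | φ.IsLinear} x C
          (SeqEst.thresholdTime h c) SeqEst.leastSquares ∧
        SeqEst.IsOptimalEstimatorAt P h w hh {φ | φ.IsLinear} x
          (SeqEst.thresholdTime h c) SeqEst.leastSquares ∧
        -- Gaussian noise: optimality among all unbiased estimators
        (P.map (w 0) = gaussianReal 0 (Real.toNNReal (σ ^ 2)) →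
          SeqEst.IsOptimalPair P h w hh Set.univ x C
            (SeqEst.thresholdTime h c) SeqEst.leastSquares ∧
          SeqEst.IsOptimalEstimatorAt P h w hh Set.univ x
            (SeqEst.thresholdTime h c) SeqEst.leastSquares)) ∧
    -- a threshold as required exists for coefficients with an atomless law
    ((∀ a : ℝ, P {ω | h 0 ω = a} = 0) →
      ENNReal.ofReal C < ∫⁻ ω, ENNReal.ofReal (σ ^ 2) / ENNReal.ofReal (h 0 ω ^ 2) ∂P →
        ∃ c : ℝ, 0 < c ∧
          ∫ ω, σ ^ 2 / SeqEst.energy h ((SeqEst.thresholdTime h c ω).untopD 0) ω ∂P = C) := by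
  have hlaw := SeqEst.map_initial_prod hh hw hw_indep hw_ident hhw
  have : IsProbabilityMeasure (P.map (w 0)) :=
    Measure.isProbabilityMeasure_map (hw 0).aemeasurable
  have hν : MemLp id 2 (P.map (w 0)) :=
    (memLp_map_measure_iff aestronglyMeasurable_id (hw 0).aemeasurable).2 hw_L2
  have hmean : ∫ y, y ∂(P.map (w 0)) = 0 := by
    rw [integral_map (f := fun y : ℝ => y) (hw 0).aemeasurable aestronglyMeasurable_id, hw_mean]
  have hvar : variance id (P.map (w 0)) = σ ^ 2 := by
    rw [variance_id_map (hw 0).aemeasurable, hw_var]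
  refine ⟨fun c hc hcC => ?_, fun hatom hCσ =>
    SeqEst.exists_threshold hh hh_indep hh_ident hh_ne hatom hσ hC hCσ⟩
  obtain ⟨hadm, hev⟩ := SeqEst.leastSquares_thresholdTime hh_indep hh_ident hh_ne hw hlaw hν hmean
    hvar hc
  have hevC := (hev x).trans (congrArg ENNReal.ofReal hcC)
  have hlin := SeqEst.isOptimalPair_thresholdTime hh_indep hh_ident hh_ne (x := x) hσ hc hcC
    (K := {φ | φ.IsLinear}) SeqEst.isLinear_leastSquares
    (fun T φ hφ hT => hT.lintegral_div_energy_le_of_isLinear hφ hw hlaw hν hmean hvar x) hadm hevC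
  refine ⟨SeqEst.expectedTime_thresholdTime_lt_top hh hh_indep hh_ident hh_ne hc, hevC, hlin.1,
    hlin.2, fun hgauss => ?_⟩
  rw [hgauss] at hlaw
  exact SeqEst.isOptimalPair_thresholdTime hh_indep hh_ident hh_ne (x := x) hσ hc hcC
    (Set.mem_univ _)
    (fun T φ _ hT => hT.lintegral_div_energy_le_of_gaussian hw hσ hlaw x) hadm hevC
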